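/- Let $(E,[\![\cdot,\cdot]\!],\rho)$ be a Lie algebroid of rank $n$ over a smooth (Hausdorff) manifold $M$ of dimension $m$, $\tau_E:E\to M$. Let $(x^i)$ be coordinates on an open set $U\subseteq M$, $\{e_A\}$ a smooth frame of $E|_U$, and let $\rho_A^i,\mathcal C_{AB}^C$ be the structure functions: $\rho(e_A)=\rho_A^i\,\partial/\partial x^i$, $[\![e_A,e_B]\!]=\mathcal C_{AB}^C e_C$. Let $\mathcal T^{\tau_E}E=\{(b,v)\in E\times TE:\rho(b)=T\tau_E(v)\}$, a Lie algebroid over $E$, and let $E^{(2)}=\{v\in T_eE: \rho(e)=T\tau_E(v)\}$ be the set of admissible elements, with coordinates $(x^i,y^A,z^A)$, where $(x^i,y^A,z^A)$ stands for the tangent vector $\rho^i_Ay^A\partial_{x^i}+z^A\partial_{y^A}$ at $e=y^Ae_A(x)$; an element $v\in E^{(2)}$ over $e$ is viewed as the element $(e,v)$ of $\mathcal T^{\tau_E}E$. Let $W_0=E^{(2)}\times_E(\mathcal T^{\tau_E}E)^*$ with projections $\pi_1:W_0\to E^{(2)}$, $\pi_2:W_0\to(\mathcal T^{\tau_E}E)^*$,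 $\nu:W_0\to E$. Let $\mathcal T^\nu\mathcal T^{\tau_E}E$ be the prolongation of $\mathcal T^{\tau_E}E$ over $\nu$, with anchor $\rho^\nu$ and differential $d$, let $\Omega_0$ be the pull-back by $(\mathrm{Id},T\pi_2)$ of the canonical symplectic section $-d\lambda$ ($\lambda$ the Liouville section of the prolongation of $\mathcal T^{\tau_E}E$ over $(\mathcal T^{\tau_E}E)^*$), and let $H(\xi,\alpha)=\langle\alpha,\xi\rangle-L(\xi)$. Let $\mathcal M\subseteq E^{(2)}$, and suppose that on an open set $D$ of the coordinate space of $E^{(2)}|_U$ the set $\mathcal M$ is given by $\Phi^\alpha(x,y,z)=0$, $\alpha=1,\dots,\bar m$, with $\Phi^\alpha$ smooth on $D$ and the rows of $(\partial\Phi^\alpha/\partial z^B)$ linearly independent at all points of $\mathcal M\cap D$. Let $L_{\mathcal M}:\mathcal M\to\mathbb R$ have an extension $L:E^{(2)}\to\mathbb R$ that is smooth on $D$. Let $\overline W_0=\pi_1^{-1}(\mathcal M\cap D)$, and let $\Omega_{\overline W_0}$, $H_{\overline W_0}$ be the restrictions of $\Omega_0$, $H$ to the subalgebroid $(\rho^\nu)^{-1}(T\overline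 W_0)$ and to $\overline W_0$ (the latter involves only $L_{\mathcal M}$). Then: 1. At each $w\in\overline W_0$, the equation $i_X\Omega_{\overline W_0}=d^{(\rho^\nu)^{-1}(T\overline W_0)}H_{\overline W_0}$ for $X\in(\rho^\nu)^{-1}(T_w\overline W_0)$ is equivalent to $i_X\Omega_0-dH\in\operatorname{ann}(\rho^\nu)^{-1}(T_w\overline W_0)$ together with $X\in(\rho^\nu)^{-1}(T_w\overline W_0)$. 2. $\operatorname{ann}(\rho^\nu)^{-1}(T_w\overline W_0)=\operatorname{span}\{d\Phi^\alpha(w)\}$, where $\Phi^\alpha$ is regarded as a function on $W_0$. Hence the equation of 1 is equivalent to: $i_X\Omega_0-dH=\mu_\alpha\,d\Phi^\alpha$ for some multipliers $\mu_\alpha\in\mathbb R$, and $X\in(\rho^\nu)^{-1}(T_w\overline W_0)$. A smooth curve in $\overline W_0$, defined on an open $I\subseteq\mathbb R$, is an integral curve of the presymplectic system (at each time its velocity is $\rho^\nu(X)$ for some solution $X$ at that point) if and only if it is one of the system with multipliers, for some smooth $\mu_\alpha:I\to\mathbb R$. 3. Let $\xi(t)=(x(t),y(t),z(t))\in D$ be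 a smooth curve on an open $I\subseteq\mathbb R$. Given smooth $\lambda_\alpha:I\to\mathbb R$, there is a smooth curve $w$ in $\overline W_0$ with $\pi_1\circ w=\xi$ that is an integral curve of the system with multipliers $\mu_\alpha=-\lambda_\alpha$ if and only if, on $I$ and for $\widetilde L=L+\lambda_\alpha\Phi^\alpha$ (partial derivatives being taken with $\lambda_\alpha$ fixed, $d/dt$ being total derivatives along the curve, including $\dot\lambda_\alpha$), $$\dot x^i=\rho_A^iy^A,\qquad \dot y^A=z^A,$$ $$0=\frac{d^2}{dt^2}\frac{\partial\widetilde L}{\partial z^A}+\mathcal C_{AB}^Cy^B\frac{d}{dt}\frac{\partial\widetilde L}{\partial z^C}-\frac{d}{dt}\frac{\partial\widetilde L}{\partial y^A}-\mathcal C_{AB}^Cy^B\frac{\partial\widetilde L}{\partial y^C}+\rho_A^i\frac{\partial\widetilde L}{\partial x^i},\qquad 0=\Phi^\alpha(x,y,z).$$ Consequently $\xi$ is the projection of a smooth integral curve of the constrained presymplectic system if and only if it satisfies these equations for some smooth multipliers $\lambda_\alpha$. -/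

import Mathlib

open scoped Manifold ContDiff Bundle Topology

noncomputable section

namespace SecondOrderAlgebroid

/-! ### Lie algebroids over a manifold -/

section Global

variable {m n : ℕ} {M : Type*} [TopologicalSpace M] [ChartedSpace (EuclideanSpace ℝ (Fin m)) M]
  {E : M → Type*} [TopologicalSpace (Bundle.TotalSpace (EuclideanSpace ℝ (Fin n)) E)]
  [∀ x, AddCommGroup (E x)] [∀ x, Module ℝ (E x)] [∀ x, TopologicalSpace (E x)]
  [FiberBundle (EuclideanSpace ℝ (Fin n)) E]

/-- The smooth sections of a rank `n` vector bundle `E` over an `m`-dimensional manifold `M`. -/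
abbrev Sec (m n : ℕ) (M : Type*) [TopologicalSpace M]
    [ChartedSpace (EuclideanSpace ℝ (Fin m)) M] (E : M → Type*)
    [TopologicalSpace (Bundle.TotalSpace (EuclideanSpace ℝ (Fin n)) E)]
    [∀ x, AddCommGroup (E x)] [∀ x, Module ℝ (E x)] [∀ x, TopologicalSpace (E x)]
    [FiberBundle (EuclideanSpace ℝ (Fin n)) E] : Type _ :=
  ContMDiffSection (𝓡 m) (EuclideanSpace ℝ (Fin n)) ∞ E

/-- The derivative `v(f)` of a function `f` in the direction of a tangent vector `v`. -/
def dirDeriv {m : ℕ} {M : Type*} [TopologicalSpace M] [ChartedSpace (EuclideanSpace ℝ (Fin m)) M]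
    (f : M → ℝ) (p : M) (v : TangentSpace (𝓡 m) p) : ℝ :=
  mfderiv (𝓡 m) 𝓘(ℝ, ℝ) f p v

/-- A Lie algebroid structure on a vector bundle `E → M` of rank `n`: a smooth anchor
`ρ : E → TM` and an `ℝ`-bilinear, antisymmetric bracket on the smooth sections of `E`, satisfying
the Jacobi identity and the Leibniz rule `⟦X, fY⟧ = f ⟦X, Y⟧ + ρ(X)(f) Y`. -/
structure LieAlgebroid (m n : ℕ) (M : Type*) [TopologicalSpace M]
    [ChartedSpace (EuclideanSpace ℝ (Fin m)) M] (E : M → Type*)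
    [TopologicalSpace (Bundle.TotalSpace (EuclideanSpace ℝ (Fin n)) E)]
    [∀ x, AddCommGroup (E x)] [∀ x, Module ℝ (E x)] [∀ x, TopologicalSpace (E x)]
    [FiberBundle (EuclideanSpace ℝ (Fin n)) E]
    [IsManifold (𝓡 m) ∞ M] [VectorBundle ℝ (EuclideanSpace ℝ (Fin n)) E] where
  anchor : ∀ p : M, E p →ₗ[ℝ] TangentSpace (𝓡 m) p
  contMDiff_anchor : ∀ X : Sec m n M E,
    ContMDiff (𝓡 m) (𝓡 m).tangent ∞
      (fun p => (⟨p, anchor p (X p)⟩ : TangentBundle (𝓡 m) M))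
  bracket : Sec m n M E → Sec m n M E → Sec m n M E
  bracket_add : ∀ X Y Z, bracket X (Y + Z) = bracket X Y + bracket X Z
  bracket_smul : ∀ (c : ℝ) X Y, bracket X (c • Y) = c • bracket X Y
  bracket_antisymm : ∀ X Y, bracket X Y = -bracket Y X
  jacobi : ∀ X Y Z,
    bracket X (bracket Y Z) + bracket Z (bracket X Y) + bracket Y (bracket Z X) = 0
  leibniz : ∀ (X Y fY : Sec m n M E) (f : M → ℝ), ContMDiff (𝓡 m) 𝓘(ℝ, ℝ) ∞ f →
    (∀ p, fY p = f p • Y p) → ∀ p,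
      bracket X fY p = f p • bracket X Y p + dirDeriv f p (anchor p (X p)) • Y p

namespace LieAlgebroid

variable [IsManifold (𝓡 m) ∞ M] [VectorBundle ℝ (EuclideanSpace ℝ (Fin n)) E]

open Classical in
/-- A global smooth section with the same germ at `p` as the given local section `s`
(see `germExt_spec`). -/
def germExt (m n : ℕ) {M : Type*} [TopologicalSpace M]
    [ChartedSpace (EuclideanSpace ℝ (Fin m)) M] {E : M → Type*}
    [TopologicalSpace (Bundle.TotalSpace (EuclideanSpace ℝ (Fin n)) E)]
    [∀ x, AddCommGroup (E x)] [∀ x, Module ℝ (E x)] [∀ x, TopologicalSpace (E x)]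
    [FiberBundle (EuclideanSpace ℝ (Fin n)) E]
    [IsManifold (𝓡 m) ∞ M] [VectorBundle ℝ (EuclideanSpace ℝ (Fin n)) E]
    (s : ∀ p, E p) (p : M) : Sec m n M E :=
  if h : ∃ σ : Sec m n M E, ∀ᶠ q in 𝓝 p, σ q = s q then h.choose else 0

theorem germExt_spec [T2Space M] [ContMDiffVectorBundle ∞ (EuclideanSpace ℝ (Fin n)) E (𝓡 m)]
    {s : ∀ p, E p} {U : Set M} (hU : IsOpen U)
    (hs : ContMDiffOn (𝓡 m) ((𝓡 m).prod 𝓘(ℝ, EuclideanSpace ℝ (Fin n))) ∞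
      (fun p => (⟨p, s p⟩ : Bundle.TotalSpace (EuclideanSpace ℝ (Fin n)) E)) U)
    {p : M} (hp : p ∈ U) : ∀ᶠ q in 𝓝 p, germExt m n s p q = s q := by
  have h : ∃ σ : Sec m n M E, ∀ᶠ q in 𝓝 p, σ q = s q := by
    obtain ⟨f, -, hf⟩ :=
      (SmoothBumpFunction.nhds_basis_tsupport (I := 𝓡 m) p).mem_iff.1 (hU.mem_nhds hp)
    refine ⟨⟨fun q => f q • s q, ?_⟩, ?_⟩
    · exact ContMDiffOn.smul_section_of_tsupport f.contMDiff.contMDiffOn hU hf hs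
    · filter_upwards [f.eventuallyEq_one] with q hq
      change f q • s q = s q
      simp [hq]
  unfold germExt
  rw [dif_pos h]
  exact h.choose_spec

/-- The bracket of local sections, evaluated at a point. -/
def localBracket (A : LieAlgebroid m n M E) (s t : ∀ p, E p) (p : M) : E p :=
  A.bracket (germExt m n s p) (germExt m n t p) p

theorem bracket_eq_of_germ [T2Space M] (A : LieAlgebroid m n M E) (X Y Y' : Sec m n M E) {p : M}
    (h : ∀ᶠ q in 𝓝 p, Y q = Y' q) : A.bracket X Y p = A.bracket X Y' p := by
  have hb0 : ∀ X : Sec m n M E, A.bracket X 0 = 0 := fun X => by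
    simpa using A.bracket_smul 0 X 0
  have hsub : A.bracket X (Y - Y') p = A.bracket X Y p - A.bracket X Y' p := by
    have h1 := A.bracket_add X (Y - Y') Y'
    rw [sub_add_cancel] at h1
    rw [h1]; simp
  obtain ⟨f, -, hf⟩ :=
    (SmoothBumpFunction.nhds_basis_tsupport (I := 𝓡 m) p).mem_iff.1 h
  have h2 := A.leibniz X (Y - Y') 0 f f.contMDiff (fun q => by
    by_cases hq : q ∈ tsupport f
    · have : Y q = Y' q := hf hq
      simp [this]
    · simp [image_eq_zero_of_notMem_tsupport hq]) p
  have h3 : Y p = Y' p := h.self_of_nhds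
  rw [hb0, f.eq_one] at h2
  have h4 : A.bracket X (Y - Y') p = 0 := by
    have hz : (Y - Y') p = 0 := by
      change Y p - Y' p = 0
      rw [h3, sub_self]
    rw [hz, one_smul, smul_zero, add_zero] at h2
    exact h2.symm
  rw [h4] at hsub
  exact (sub_eq_zero.1 hsub.symm)

/-- The local bracket does not depend on the extensions. -/
theorem localBracket_eq [T2Space M] (A : LieAlgebroid m n M E) {s t : ∀ p, E p}
    {X Y : Sec m n M E} {p : M} (hX : ∀ᶠ q in 𝓝 p, X q = s q) (hY : ∀ᶠ q in 𝓝 p, Y q = t q) :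
    A.localBracket s t p = A.bracket X Y p := by
  have key : ∀ {s : ∀ p, E p} {X : Sec m n M E}, (∀ᶠ q in 𝓝 p, X q = s q) →
      ∀ᶠ q in 𝓝 p, germExt m n s p q = X q := by
    intro s X hX
    have h : ∃ σ : Sec m n M E, ∀ᶠ q in 𝓝 p, σ q = s q := ⟨X, hX⟩
    have hc := h.choose_spec
    unfold germExt
    rw [dif_pos h]
    filter_upwards [hc, hX] with q h1 h2
    rw [h1, h2]
  unfold localBracket
  rw [A.bracket_eq_of_germ _ _ _ (key hY), A.bracket_antisymm, A.bracket_antisymm X Y]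
  simp [A.bracket_eq_of_germ _ _ _ (key hX)]

/-- The set `E⁽²⁾` of admissible elements: tangent vectors `v ∈ T_e E` with `Tτ_E (v) = ρ(e)`. -/
def admissible (A : LieAlgebroid m n M E) :
    Set (TangentBundle ((𝓡 m).prod 𝓘(ℝ, EuclideanSpace ℝ (Fin n)))
      (Bundle.TotalSpace (EuclideanSpace ℝ (Fin n)) E)) :=
  {ξ | mfderiv ((𝓡 m).prod 𝓘(ℝ, EuclideanSpace ℝ (Fin n))) (𝓡 m)
    (Bundle.TotalSpace.proj : Bundle.TotalSpace (EuclideanSpace ℝ (Fin n)) E → M) ξ.1 ξ.2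
      = A.anchor ξ.1.1 ξ.1.2}

end LieAlgebroid

end Global

/-! ### Coordinates -/

/-- Coordinate space of the base, with coordinates `(xⁱ)`. -/
abbrev X (m : ℕ) := EuclideanSpace ℝ (Fin m)

/-- Fibre coordinates `(y^A)`. -/
abbrev Y (n : ℕ) := Fin n → ℝ

/-- Coordinates `((x, y), z)` on `E⁽²⁾`. -/
abbrev E2 (m n : ℕ) := (X m × Y n) × Y n

/-! ### Algebroids on trivial bundles

All objects over a coordinate domain with a fixed frame live on trivial bundles. -/

/-- Anchor and bracket of an algebroid on the trivial bundle with fibre `F` over (an open subset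
of) a vector space `V`: `str x a b` is the value at `x` of the bracket of the constant sections
`a` and `b`; it determines the bracket of all sections by the Leibniz rule. -/
structure TrivAlgebroid (V F : Type*) [NormedAddCommGroup V] [NormedSpace ℝ V]
    [NormedAddCommGroup F] [NormedSpace ℝ F] where
  anchor : V → F →ₗ[ℝ] V
  str : V → F →ₗ[ℝ] F →ₗ[ℝ] F

namespace TrivAlgebroid

variable {V F G : Type*} [NormedAddCommGroup V] [NormedSpace ℝ V]
  [NormedAddCommGroup F] [NormedSpace ℝ F] [NormedAddCommGroup G] [NormedSpace ℝ G]

/-- The prolongation of an algebroid over the projection `V × G → V`. Its fibre at `(x, g)` is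
`{(b, v) | ρ b = Tπ v}`; as `v = (ρ b, u)` with `u : G` free, it is identified with `F × G`
(see `mem_range_prolong`), the anchor is `(b, v) ↦ v`, and the only non-vanishing brackets of
constant sections are those of the algebroid itself. -/
def prolong (B : TrivAlgebroid V F) (G : Type*) [NormedAddCommGroup G] [NormedSpace ℝ G] :
    TrivAlgebroid (V × G) (F × G) where
  anchor q := (B.anchor q.1).prodMap LinearMap.id
  str q := ((B.str q.1).compr₂ (LinearMap.inl ℝ F G)).compl₁₂
    (LinearMap.fst ℝ F G) (LinearMap.fst ℝ F G)

theorem mem_range_prolong (B : TrivAlgebroid V F) (q : V × G) (b : F) (v : V × G) :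
    (∃ a : F × G, a.1 = b ∧ (B.prolong G).anchor q a = v) ↔
      B.anchor q.1 b = fderiv ℝ (Prod.fst : V × G → V) q v := by
  have h : fderiv ℝ (Prod.fst : V × G → V) q v = v.1 := by
    rw [fderiv_fst]; rfl
  rw [h]
  constructor
  · rintro ⟨a, rfl, rfl⟩
    rfl
  · intro h'
    exact ⟨(b, v.2), rfl, Prod.ext h' rfl⟩

/-- The differential of a function: `(d f)(a) = ρ(a) f`. -/
def dFun (B : TrivAlgebroid V F) (f : V → ℝ) (x : V) : F →ₗ[ℝ] ℝ :=
  (fderiv ℝ f x : V →ₗ[ℝ] ℝ) ∘ₗ B.anchor x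

/-- The differential of a `1`-section on constant sections:
`(d θ)(a, b) = ρ(a)(θ(b)) - ρ(b)(θ(a)) - θ(⟦a, b⟧)`. -/
def dOne (B : TrivAlgebroid V F) (θ : V → F →L[ℝ] ℝ) (x : V) : F →ₗ[ℝ] F →ₗ[ℝ] ℝ :=
  let D : F →ₗ[ℝ] F →ₗ[ℝ] ℝ :=
    (ContinuousLinearMap.coeLM ℝ) ∘ₗ (fderiv ℝ θ x : V →ₗ[ℝ] F →L[ℝ] ℝ) ∘ₗ B.anchor x
  D - D.flip - (B.str x).compr₂ (θ x : F →ₗ[ℝ] ℝ)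

/-- The Liouville section `λ(α)(b, v) = ⟨α, b⟩` of the prolongation over the dual bundle. -/
def liouville (V F : Type*) [NormedAddCommGroup V] [NormedSpace ℝ V]
    [NormedAddCommGroup F] [NormedSpace ℝ F] (q : V × (F →L[ℝ] ℝ)) :
    F × (F →L[ℝ] ℝ) →L[ℝ] ℝ :=
  q.2.comp (ContinuousLinearMap.fst ℝ F (F →L[ℝ] ℝ))

/-- The canonical symplectic section `Ω = -dλ` on the prolongation over the dual bundle. -/
def canonicalForm (B : TrivAlgebroid V F) (q : V × (F →L[ℝ] ℝ)) :
    (F × (F →L[ℝ] ℝ)) →ₗ[ℝ] (F × (F →L[ℝ] ℝ)) →ₗ[ℝ] ℝ :=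
  -(B.prolong (F →L[ℝ] ℝ)).dOne (liouville V F) q

end TrivAlgebroid

/-! ### The presymplectic system on `W₀ = E⁽²⁾ ×_E (𝒯E)*`

Here `𝒯E` is the prolongation of `E` over `τ_E`, an algebroid over `E` with fibre `Y n × Y n`. -/

/-- The dual fibre of `𝒯E`, with coordinates `p_A = α(e_A, 0)` and `p̄_A = α(0, e_A)`. -/
abbrev P (n : ℕ) := (Y n × Y n) →L[ℝ] ℝ

/-- Coordinates `((x, y), (z, α))` on `W₀`. -/
abbrev W (m n : ℕ) := (X m × Y n) × (Y n × P n)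

/-- The fibre of `𝒯^ν 𝒯E`. -/
abbrev TW (n : ℕ) := (Y n × Y n) × (Y n × P n)

/-- The projection `π₁ : W₀ → E⁽²⁾`. -/
def π₁ {m n : ℕ} (w : W m n) : E2 m n := (w.1, w.2.1)

/-- Velocities at `w` of the smooth curves contained in `S`; this is the tangent space `T_w S` if
`S` is an embedded submanifold. -/
def velocities {V : Type*} [NormedAddCommGroup V] [NormedSpace ℝ V] (S : Set V) (w : V) : Set V :=
  {v | ∃ c : ℝ → V, ContDiffAt ℝ ∞ c 0 ∧ c 0 = w ∧ (∀ᶠ t in 𝓝 0, c t ∈ S) ∧ HasDerivAt c v 0}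

section System

variable {m n k : ℕ} (B : TrivAlgebroid (X m) (Y n))

/-- The algebroid `𝒯E` over `E`. -/
def tangentE : TrivAlgebroid (X m × Y n) (Y n × Y n) := B.prolong (Y n)

/-- The algebroid `𝒯^ν 𝒯E` over `W₀`, where `ν : W₀ → E`. -/
def tangentW : TrivAlgebroid (W m n) (TW n) := (tangentE B).prolong (Y n × P n)

/-- The presymplectic section `Ω₀ = (𝒯π₂, π₂)^* Ω` on `W₀`, where `π₂ : W₀ → (𝒯E)*` and
`𝒯π₂ = (Id, Tπ₂)`. -/
def Omega0 (w : W m n) : TW n →ₗ[ℝ] TW n →ₗ[ℝ] ℝ :=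
  let Tπ₂ : TW n →ₗ[ℝ] (Y n × Y n) × P n := LinearMap.prodMap LinearMap.id (LinearMap.snd ℝ _ _)
  ((tangentE B).canonicalForm (w.1, w.2.2)).compl₁₂ Tπ₂ Tπ₂

/-- The Pontryagin Hamiltonian `H(ξ, α) = ⟨α, ξ⟩ - L(ξ)`, where `ξ = (x, y, z) ∈ E⁽²⁾` is
the element `(y, z)` of the fibre of `𝒯E` at `(x, y)`. -/
def pontryagin (L : E2 m n → ℝ) (w : W m n) : ℝ := w.2.2 (w.1.2, w.2.1) - L (π₁ w)

/-- The fibre at `w` of the subalgebroid `(ρ^ν)⁻¹(T S)`, for `S ⊆ W₀`. -/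
def tangentSub (S : Set (W m n)) (w : W m n) : Set (TW n) :=
  {Z | (tangentW B).anchor w Z ∈ velocities S w}

/-- The annihilator of the fibre of `(ρ^ν)⁻¹(T S)` at `w`. -/
def ann (S : Set (W m n)) (w : W m n) : Set (TW n →ₗ[ℝ] ℝ) :=
  {θ | ∀ Z ∈ tangentSub B S w, θ Z = 0}

/-- The equation `i_X Ω_S = d H_S` at `w ∈ S`, on the restricted algebroid `(ρ^ν)⁻¹(T S)`:
for each `Z` in it, `(d H_S)(Z)` is the derivative of `H_S` along a curve in `S` with velocity
`ρ^ν(Z)`. Only the values on `S` of the function `H` are used. -/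
def IntrinsicEq (S : Set (W m n)) (H : W m n → ℝ) (w : W m n) (Z : TW n) : Prop :=
  Z ∈ tangentSub B S w ∧ ∀ Z' ∈ tangentSub B S w, ∀ c : ℝ → W m n, ContDiffAt ℝ ∞ c 0 → c 0 = w →
    (∀ᶠ t in 𝓝 0, c t ∈ S) → HasDerivAt c ((tangentW B).anchor w Z') 0 →
      HasDerivAt (fun t => H (c t)) (Omega0 B w Z Z') 0

/-- The one-section `i_X Ω₀ - dH` at `w`. -/
def defect (L : E2 m n → ℝ) (w : W m n) (Z : TW n) : TW n →ₗ[ℝ] ℝ :=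
  Omega0 B w Z - (tangentW B).dFun (pontryagin L) w

/-- The differential `d Φ^α` at `w` of the constraint `Φ^α`, regarded as a function on `W₀`. -/
def dConstraint (Φ : Fin k → E2 m n → ℝ) (a : Fin k) (w : W m n) : TW n →ₗ[ℝ] ℝ :=
  (tangentW B).dFun (fun w' => Φ a (π₁ w')) w

/-- `w` is, on `I`, an integral curve of the presymplectic system `i_X Ω_S = d H_S`. -/
def SolvesIntrinsic (S : Set (W m n)) (H : W m n → ℝ) (I : Set ℝ) (w : ℝ → W m n) : Prop :=
  ∀ t ∈ I, w t ∈ S ∧ ∃ Z : TW n, HasDerivAt w ((tangentW B).anchor (w t) Z) t ∧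
    IntrinsicEq B S H (w t) Z

/-- `w` is, on `I`, an integral curve of the extrinsic system `i_X Ω₀ - dH = μ_α dΦ^α`,
`X ∈ (ρ^ν)⁻¹(T S)` along `S`, with the multipliers `μ`. -/
def SolvesExtrinsic (S : Set (W m n)) (L : E2 m n → ℝ) (Φ : Fin k → E2 m n → ℝ)
    (I : Set ℝ) (w : ℝ → W m n) (μ : ℝ → Fin k → ℝ) : Prop :=
  ∀ t ∈ I, w t ∈ S ∧ ∃ Z : TW n, HasDerivAt w ((tangentW B).anchor (w t) Z) t ∧
    Z ∈ tangentSub B S (w t) ∧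
    defect B L (w t) Z = ∑ a, μ t a • dConstraint B Φ a (w t)

end System

/-! ### The second-order Euler–Lagrange equations -/

section EulerLagrange

variable {m n k : ℕ}

/-- `∂f/∂xⁱ` at a point of `E⁽²⁾`. -/
def pdx (f : E2 m n → ℝ) (i : Fin m) (ξ : E2 m n) : ℝ :=
  fderiv ℝ f ξ ((EuclideanSpace.single i 1, 0), 0)

/-- `∂f/∂y^A` at a point of `E⁽²⁾`. -/
def pdy (f : E2 m n → ℝ) (A : Fin n) (ξ : E2 m n) : ℝ :=
  fderiv ℝ f ξ ((0, Pi.single A 1), 0)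

/-- `∂f/∂z^A` at a point of `E⁽²⁾`. -/
def pdz (f : E2 m n → ℝ) (A : Fin n) (ξ : E2 m n) : ℝ :=
  fderiv ℝ f ξ ((0, 0), Pi.single A 1)

/-- The augmented Lagrangian `L̃ = L + λ_α Φ^α`. -/
def augmented (L : E2 m n → ℝ) (Φ : Fin k → E2 m n → ℝ) (l : Fin k → ℝ) (ξ : E2 m n) : ℝ :=
  L ξ + ∑ a, l a * Φ a ξ

/-- `ξ(t) = (x(t), y(t), z(t))` with multipliers `λ(t)` solves, on `I`, the constrained second-order
Euler–Lagrange equations for `L̃ = L + λ_α Φ^α` on the algebroid with structure functions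
`ρ_A^i = rho A i` and `C_{AB}^C = C A B C`. -/
def IsEulerLagrange (rho : Fin n → Fin m → X m → ℝ) (C : Fin n → Fin n → Fin n → X m → ℝ)
    (L : E2 m n → ℝ) (Φ : Fin k → E2 m n → ℝ) (I : Set ℝ)
    (ξ : ℝ → E2 m n) (l : ℝ → Fin k → ℝ) : Prop :=
  let Lt : ℝ → E2 m n → ℝ := fun t => augmented L Φ (l t)
  ∀ t ∈ I,
    (∀ i, HasDerivAt (fun s => (ξ s).1.1 i) (∑ A, rho A i (ξ t).1.1 * (ξ t).1.2 A) t) ∧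
    (∀ A, HasDerivAt (fun s => (ξ s).1.2 A) ((ξ t).2 A) t) ∧
    (∀ A, 0 = deriv (deriv fun s => pdz (Lt s) A (ξ s)) t
      + ∑ B, ∑ D, C A B D (ξ t).1.1 * (ξ t).1.2 B * deriv (fun s => pdz (Lt s) D (ξ s)) t
      - deriv (fun s => pdy (Lt s) A (ξ s)) t
      - ∑ B, ∑ D, C A B D (ξ t).1.1 * (ξ t).1.2 B * pdy (Lt t) D (ξ t)
      + ∑ i, rho A i (ξ t).1.1 * pdx (Lt t) i (ξ t)) ∧
    (∀ a, Φ a (ξ t) = 0)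

end EulerLagrange

/-! ### Local expression of a Lie algebroid in a chart and a frame -/

namespace LieAlgebroid

variable {m n : ℕ} {M : Type*} [TopologicalSpace M] [ChartedSpace (EuclideanSpace ℝ (Fin m)) M]
  {E : M → Type*} [TopologicalSpace (Bundle.TotalSpace (EuclideanSpace ℝ (Fin n)) E)]
  [∀ x, AddCommGroup (E x)] [∀ x, Module ℝ (E x)] [∀ x, TopologicalSpace (E x)]
  [FiberBundle (EuclideanSpace ℝ (Fin n)) E]
  [IsManifold (𝓡 m) ∞ M] [VectorBundle ℝ (EuclideanSpace ℝ (Fin n)) E]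
  (A : LieAlgebroid m n M E)
  (φ : OpenPartialHomeomorph M (EuclideanSpace ℝ (Fin m))) {e : Fin n → ∀ p, E p}

/-- The structure functions `ρ_A^i`, given by `ρ(e_A) = ρ_A^i ∂/∂xⁱ`. -/
def rho (e : Fin n → ∀ p, E p) (a : Fin n) (i : Fin m) (x : X m) : ℝ :=
  (show X m from mfderiv (𝓡 m) 𝓘(ℝ, X m) φ (φ.symm x)
    (A.anchor (φ.symm x) (e a (φ.symm x)))) i

/-- The structure functions `C_{AB}^C`, given by `⟦e_A, e_B⟧ = C_{AB}^C e_C`. -/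
def structC (he : IsLocalFrameOn (𝓡 m) (EuclideanSpace ℝ (Fin n)) ∞ e φ.source)
    (a b c : Fin n) (x : X m) : ℝ :=
  he.coeff c (φ.symm x) (A.localBracket (e a) (e b) (φ.symm x))

/-- The algebroid on the trivial bundle over the coordinate domain `φ.target`, which is the
expression of `A` in the chart `φ` and the frame `e`. -/
def localForm (he : IsLocalFrameOn (𝓡 m) (EuclideanSpace ℝ (Fin n)) ∞ e φ.source) :
    TrivAlgebroid (X m) (Y n) where
  anchor x := ∑ a, (LinearMap.proj a : Y n →ₗ[ℝ] ℝ).smulRight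
    (∑ i, A.rho φ e a i x • EuclideanSpace.single i (1 : ℝ))
  str x := ∑ a, ∑ b, ∑ c, A.structC φ he a b c x •
    ((LinearMap.mul ℝ ℝ).compl₁₂ (LinearMap.proj a : Y n →ₗ[ℝ] ℝ)
      (LinearMap.proj b : Y n →ₗ[ℝ] ℝ)).compr₂ (LinearMap.single ℝ (fun _ : Fin n => ℝ) c)

/-- The element `y^A e_A(x)` of `E` with coordinates `(x, y)`. -/
def point (e : Fin n → ∀ p, E p) (q : X m × Y n) :
    Bundle.TotalSpace (EuclideanSpace ℝ (Fin n)) E :=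
  ⟨φ.symm q.1, ∑ a, q.2 a • e a (φ.symm q.1)⟩

/-- The element of `E⁽²⁾` with coordinates `(x, y, z)`: the tangent vector
`ρ_A^i y^A ∂/∂xⁱ + z^A ∂/∂y^A` at the element of `E` with coordinates `(x, y)`. -/
def elem (he : IsLocalFrameOn (𝓡 m) (EuclideanSpace ℝ (Fin n)) ∞ e φ.source) (ξ : E2 m n) :
    TangentBundle ((𝓡 m).prod 𝓘(ℝ, EuclideanSpace ℝ (Fin n)))
      (Bundle.TotalSpace (EuclideanSpace ℝ (Fin n)) E) :=
  ⟨point φ e ξ.1, mfderiv 𝓘(ℝ, X m × Y n) ((𝓡 m).prod 𝓘(ℝ, EuclideanSpace ℝ (Fin n)))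
    (point φ e) ξ.1 ((A.localForm φ he).anchor ξ.1.1 ξ.1.2, ξ.2)⟩

theorem elem_mem_admissible [ContMDiffVectorBundle ∞ (EuclideanSpace ℝ (Fin n)) E (𝓡 m)]
    (hφ : φ ∈ IsManifold.maximalAtlas (𝓡 m) ∞ M)
    (he : IsLocalFrameOn (𝓡 m) (EuclideanSpace ℝ (Fin n)) ∞ e φ.source) (ξ : E2 m n)
    (hξ : ξ.1.1 ∈ φ.target) : A.elem φ he ξ ∈ A.admissible := by
  have hx : φ.symm ξ.1.1 ∈ φ.source := φ.map_target hξ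
  have hne : (∞ : WithTop ℕ∞) ≠ 0 := by simp
  -- the parametrization is differentiable
  have hsym : ContMDiffAt 𝓘(ℝ, X m) (𝓡 m) ∞ φ.symm ξ.1.1 :=
    (contMDiffOn_symm_of_mem_maximalAtlas hφ).contMDiffAt (φ.open_target.mem_nhds hξ)
  have hbase : ContMDiffAt 𝓘(ℝ, X m × Y n) (𝓡 m) ∞ (fun q : X m × Y n => φ.symm q.1) ξ.1 :=
    ContMDiffAt.comp (g := φ.symm) ξ.1 hsym
      (contDiff_fst (𝕜 := ℝ) (E := X m) (F := Y n)).contMDiff.contMDiffAt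
  have hpt : ContMDiffAt 𝓘(ℝ, X m × Y n) ((𝓡 m).prod 𝓘(ℝ, EuclideanSpace ℝ (Fin n))) ∞
      (point φ e) ξ.1 := by
    rw [Bundle.contMDiffAt_totalSpace]
    refine ⟨hbase, ?_⟩
    set T := trivializationAt (EuclideanSpace ℝ (Fin n)) E (φ.symm ξ.1.1) with hT
    have hfr : ∀ a, ContMDiffAt 𝓘(ℝ, X m × Y n) 𝓘(ℝ, EuclideanSpace ℝ (Fin n)) ∞
        (fun q : X m × Y n => (T ⟨φ.symm q.1, e a (φ.symm q.1)⟩).2) ξ.1 := by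
      intro a
      have h1 := (he.contMDiffOn a).contMDiffAt (φ.open_source.mem_nhds hx)
      have h2 := (Bundle.contMDiffAt_section _).1 h1
      exact ContMDiffAt.comp (g := fun p => (T ⟨p, e a p⟩).2)
        (f := fun q : X m × Y n => φ.symm q.1) ξ.1 h2 hbase
    have hsum : ContMDiffAt 𝓘(ℝ, X m × Y n) 𝓘(ℝ, EuclideanSpace ℝ (Fin n)) ∞
        (fun q : X m × Y n => ∑ a, q.2 a • (T ⟨φ.symm q.1, e a (φ.symm q.1)⟩).2) ξ.1 := by
      rw [contMDiffAt_iff_contDiffAt]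
      refine ContDiffAt.sum fun a _ => ?_
      have h3 : ContDiffAt ℝ ∞ (fun q : X m × Y n => q.2 a) ξ.1 := by fun_prop
      exact h3.smul (contMDiffAt_iff_contDiffAt.1 (hfr a))
    refine hsum.congr_of_eventuallyEq ?_
    have hU : ∀ᶠ q : X m × Y n in 𝓝 ξ.1, φ.symm q.1 ∈ T.baseSet :=
      hbase.continuousAt.eventually (T.open_baseSet.mem_nhds
        (FiberBundle.mem_baseSet_trivializationAt' _))
    filter_upwards [hU] with q hq
    have hlin : ∀ v : E (φ.symm q.1), (T ⟨φ.symm q.1, v⟩).2 = T.linearMapAt ℝ _ v := fun v => by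
      rw [Bundle.Trivialization.linearMapAt_apply, if_pos hq]
    change (T ⟨φ.symm q.1, ∑ a, q.2 a • e a (φ.symm q.1)⟩).2 = _
    rw [hlin, map_sum]
    exact Finset.sum_congr rfl fun a _ => by rw [map_smul, ← hlin]
  have hemb : φ.MDifferentiable (𝓡 m) 𝓘(ℝ, X m) :=
    ⟨(contMDiffOn_of_mem_maximalAtlas hφ).mdifferentiableOn hne,
      (contMDiffOn_symm_of_mem_maximalAtlas hφ).mdifferentiableOn hne⟩
  -- the anchor in coordinates
  have hanch : (A.localForm φ he).anchor ξ.1.1 ξ.1.2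
      = (mfderiv (𝓡 m) 𝓘(ℝ, X m) φ (φ.symm ξ.1.1)
        (A.anchor (φ.symm ξ.1.1) (∑ a, ξ.1.2 a • e a (φ.symm ξ.1.1))) : X m) := by
    have hv : ∀ v : X m, ∑ i, v i • EuclideanSpace.single i (1 : ℝ) = v := fun v => by
      ext j; simp [Finset.sum_apply, Pi.single_apply]
    rw [map_sum, map_sum]
    simp only [localForm, LinearMap.sum_apply, LinearMap.smulRight_apply, LinearMap.proj_apply]
    refine Finset.sum_congr rfl fun a _ => ?_
    rw [map_smul, map_smul]
    congr 1
    exact hv _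
  change mfderiv _ (𝓡 m) _ (point φ e ξ.1) (mfderiv 𝓘(ℝ, X m × Y n) _ (point φ e) ξ.1 _) = _
  have hproj : MDifferentiableAt ((𝓡 m).prod 𝓘(ℝ, EuclideanSpace ℝ (Fin n))) (𝓡 m)
      (Bundle.TotalSpace.proj : Bundle.TotalSpace (EuclideanSpace ℝ (Fin n)) E → M)
      (point φ e ξ.1) := Bundle.mdifferentiableAt_proj E
  have hc1 := mfderiv_comp_apply ξ.1 hproj (hpt.mdifferentiableAt hne)
    ((A.localForm φ he).anchor ξ.1.1 ξ.1.2, ξ.2)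
  have hc2 := mfderiv_comp_apply (I := 𝓘(ℝ, X m × Y n)) (f := (Prod.fst : X m × Y n → X m)) ξ.1
    (hsym.mdifferentiableAt hne)
    ((contDiff_fst (𝕜 := ℝ) (E := X m) (F := Y n)).contMDiff.contMDiffAt.mdifferentiableAt
      (n := ∞) hne)
    ((A.localForm φ he).anchor ξ.1.1 ξ.1.2, ξ.2)
  have hfst : mfderiv 𝓘(ℝ, X m × Y n) 𝓘(ℝ, X m) (Prod.fst : X m × Y n → X m) ξ.1
      ((A.localForm φ he).anchor ξ.1.1 ξ.1.2, ξ.2) = (A.localForm φ he).anchor ξ.1.1 ξ.1.2 := by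
    rw [mfderiv_eq_fderiv, fderiv_fst]; rfl
  have hinv := DFunLike.congr_fun (hemb.symm_comp_deriv hx)
    (A.anchor (φ.symm ξ.1.1) (∑ a, ξ.1.2 a • e a (φ.symm ξ.1.1)))
  rw [← hc1]
  refine hc2.trans ?_
  rw [hfst, hanch]
  rw [φ.right_inv hξ] at hinv
  exact hinv

/-- The subset of the coordinate space of `E⁽²⁾` corresponding to `N ⊆ E⁽²⁾`. -/
def exprSet (he : IsLocalFrameOn (𝓡 m) (EuclideanSpace ℝ (Fin n)) ∞ e φ.source)
    (N : Set (TangentBundle ((𝓡 m).prod 𝓘(ℝ, EuclideanSpace ℝ (Fin n)))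
      (Bundle.TotalSpace (EuclideanSpace ℝ (Fin n)) E))) : Set (E2 m n) :=
  {ξ | A.elem φ he ξ ∈ N}

open Classical in
/-- The expression in coordinates of a function defined on a subset `N` of `E⁽²⁾` (with the value
`0` at coordinates of points outside `N`). -/
def expr (he : IsLocalFrameOn (𝓡 m) (EuclideanSpace ℝ (Fin n)) ∞ e φ.source)
    {N : Set (TangentBundle ((𝓡 m).prod 𝓘(ℝ, EuclideanSpace ℝ (Fin n)))
      (Bundle.TotalSpace (EuclideanSpace ℝ (Fin n)) E))} (f : N → ℝ) (ξ : E2 m n) : ℝ :=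
  if h : A.elem φ he ξ ∈ N then f ⟨A.elem φ he ξ, h⟩ else 0

end LieAlgebroid

/-- The part of `W̄₀ = pr₁⁻¹(𝓜)` lying over the coordinate domain `D`, when `N` is the expression
of `𝓜` in coordinates. -/
def Wbar {m n : ℕ} (D N : Set (E2 m n)) : Set (W m n) := {w | π₁ w ∈ D ∧ π₁ w ∈ N}

end SecondOrderAlgebroid

end

open SecondOrderAlgebroid

/-! Everything rests on the fact that `z` is a free direction: the anchor of `tangentW` is the
identity on it and `π₁` keeps it. Full rank of the Φ^α in `z` therefore makes the part of W̄₀ over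
`D` a regular level set of Φ ∘ π₁, and keeps the sections dΦ^α independent. By the implicit function
theorem the velocities of curves in W̄₀ fill the kernel of the derivative of Φ ∘ π₁, so the
restricted subalgebroid is the common kernel of the dΦ^α (`mem_tangentSub_iff`), and linear algebra
gives its annihilator (`ann_eq_span`). The derivative of `H` along a curve in W̄₀ is dH applied to
its velocity, whatever extension is used off 𝓜; this turns the intrinsic equation into the extrinsic
one (`intrinsicEq_iff`) and produces multipliers. Smoothness of the multipliers comes from the `z`
components of the equation, a linear system for μ of full rank with smooth data
(`contDiffOn_multipliers`).

For the Euler–Lagrange equations, write p_A = α(e_A, 0) and p̄_A = α(0, e_A). With μ = -λ the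
multiplier terms merge with dL into the derivative of L̃ at frozen λ, and the equation splits
(`defect_eq_iff`) into ẋ = ρy, ẏ = z; p̄_A = ∂L̃/∂z^A; dp̄_A/dt = ∂L̃/∂y^A - p_A; dp_A/dt =
-C_{AB}^D y^B p_D + ρ_A^i ∂L̃/∂x^i. The second and third relations determine the momenta from the
base curve and λ, and the last one then becomes the second-order equation
(`exists_solvesExtrinsic_iff`). Composition with the multiplier result gives the dynamics of the
presymplectic system. -/

namespace SecondOrderAlgebroid

/-! ### Regular level sets and smooth dependence of linear coefficients -/

/-- A vector in the kernel of a surjective derivative is the velocity of a smooth curve in the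
level set. -/
theorem exists_curve_of_fderiv_apply_eq_zero {V Q : Type*} [NormedAddCommGroup V] [NormedSpace ℝ V]
    [NormedAddCommGroup Q] [NormedSpace ℝ Q] [FiniteDimensional ℝ Q]
    {F : V → Q} {w : V} (hF : ContDiffAt ℝ ∞ F w)
    (hsurj : Function.Surjective (fderiv ℝ F w)) {v : V} (hv : fderiv ℝ F w v = 0) :
    ∃ c : ℝ → V, ContDiffAt ℝ ∞ c 0 ∧ c 0 = w ∧ (∀ᶠ t in 𝓝 0, F (c t) = F w) ∧
      HasDerivAt c v 0 := by
  have : CompleteSpace Q := FiniteDimensional.complete ℝ Q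
  have hne : (∞ : WithTop ℕ∞) ≠ 0 := by simp
  obtain ⟨R₀, hR₀⟩ := (fderiv ℝ F w : V →ₗ[ℝ] Q).exists_rightInverse_of_surjective
    (LinearMap.range_eq_top.2 hsurj)
  let R : Q →L[ℝ] V := LinearMap.toContinuousLinearMap R₀
  have hR : ∀ s, fderiv ℝ F w (R s) = s := fun s => DFunLike.congr_fun hR₀ s
  -- The curve is sought as w + t v + R ψ(t), with `R` a right inverse of the derivative.
  -- Restricting `F` to this finite-dimensional slice lets the implicit function theorem apply
  -- without completeness of `V`.
  let j : ℝ × Q →L[ℝ] V := (ContinuousLinearMap.fst ℝ ℝ Q).smulRight v +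
    R.comp (ContinuousLinearMap.snd ℝ ℝ Q)
  let g : ℝ × Q → V := fun q => w + j q
  have hg : ∀ q, HasFDerivAt g j q := fun q => j.hasFDerivAt.const_add w
  have hg0 : g 0 = w := by simp [g]
  have hgs : ContDiff ℝ ∞ g := contDiff_const.add j.contDiff
  have hf : ContDiffAt ℝ ∞ (F ∘ g) 0 := ContDiffAt.comp 0 (by rwa [hg0]) hgs.contDiffAt
  have hfd : fderiv ℝ (F ∘ g) 0 = (fderiv ℝ F w).comp j := by
    have h1 : HasFDerivAt F (fderiv ℝ F w) (g 0) := by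
      rw [hg0]; exact (hF.differentiableAt hne).hasFDerivAt
    exact (h1.comp 0 (hg 0)).fderiv
  -- The partial derivative in `Q` is the identity, so ψ exists; the one in `t` is zero because `v`
  -- lies in the kernel, so ψ'(0) = 0 and the velocity is exactly `v`.
  have hinr : fderiv ℝ (F ∘ g) 0 ∘L .inr ℝ ℝ Q = .id ℝ Q := by
    rw [hfd]; ext s; simp [j, hR]
  have hinl : fderiv ℝ (F ∘ g) 0 ∘L .inl ℝ ℝ Q = 0 := by
    rw [hfd]; ext; simp [j, hv]
  have hinv : (fderiv ℝ (F ∘ g) 0 ∘L .inr ℝ ℝ Q).IsInvertible := by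
    rw [hinr]; exact ⟨.refl ℝ Q, rfl⟩
  have hψ0 : hf.implicitFunction hne hinv 0 = 0 := hf.implicitFunction_apply_self hne hinv
  have hψ : ∀ᶠ t in 𝓝 (0 : ℝ), (F ∘ g) (t, hf.implicitFunction hne hinv t) = (F ∘ g) 0 :=
    hf.eventually_apply_implicitFunction hne hinv
  have hψs : ContDiffAt ℝ ∞ (hf.implicitFunction hne hinv) 0 :=
    hf.contDiffAt_implicitFunction hne hinv
  have hψd : HasDerivAt (hf.implicitFunction hne hinv) 0 0 := by
    have h := (hf.hasStrictFDerivAt_implicitFunction hne hinv).hasFDerivAt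
    rw [hinl] at h
    simpa using h.hasDerivAt
  set ψ := hf.implicitFunction hne hinv
  refine ⟨fun t => g (t, ψ t), hgs.contDiffAt.comp 0 (contDiffAt_id.prodMk hψs), ?_, ?_, ?_⟩
  · change g (0, ψ 0) = w
    rw [hψ0]; exact hg0
  · filter_upwards [hψ] with t ht
    simpa [hg0] using ht
  · have h := (hg (0, ψ 0)).comp_hasDerivAt (0 : ℝ) ((hasDerivAt_id (0 : ℝ)).prodMk hψd)
    simpa [j, Function.comp_def] using h

/-- The coefficients of a smooth combination of smooth, linearly independent vectors are smooth. -/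
theorem contDiffAt_coeff_of_linearIndependent {F ι : Type*} [NormedAddCommGroup F]
    [NormedSpace ℝ F] [FiniteDimensional ℝ F] [Fintype ι] {g : ι → ℝ → F} {b : ℝ → F}
    {μ : ℝ → ι → ℝ} {t₀ : ℝ} (hg : ∀ a, ContDiffAt ℝ ∞ (g a) t₀) (hb : ContDiffAt ℝ ∞ b t₀)
    (hli : LinearIndependent ℝ fun a => g a t₀)
    (hμ : ∀ᶠ t in 𝓝 t₀, b t = ∑ a, μ t a • g a t) : ContDiffAt ℝ ∞ μ t₀ := by
  let A : ℝ → (ι → ℝ) →L[ℝ] F := fun t =>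
    ∑ a, (ContinuousLinearMap.proj (R := ℝ) (φ := fun _ : ι => ℝ) a).smulRight (g a t)
  have hA : ∀ t c, A t c = ∑ a, c a • g a t := fun t c => by simp [A]
  have hAs : ContDiffAt ℝ ∞ A t₀ := ContDiffAt.sum fun a _ =>
    (ContinuousLinearMap.smulRightL ℝ (ι → ℝ) F
      (ContinuousLinearMap.proj (R := ℝ) (φ := fun _ : ι => ℝ) a)).contDiff.contDiffAt.comp t₀
      (hg a)
  have hinj : Function.Injective (A t₀) := by
    rw [injective_iff_map_eq_zero]
    intro c hc
    rw [hA] at hc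
    exact funext (Fintype.linearIndependent_iff.1 hli c hc)
  -- With `K` a left inverse of A(t₀), the square map K ∘ A(t) is invertible near t₀, and μ = (K ∘
  -- A)⁻¹ K b is smooth because inversion is.
  obtain ⟨K₀, hK₀⟩ := (A t₀ : (ι → ℝ) →ₗ[ℝ] F).exists_leftInverse_of_injective
    (LinearMap.ker_eq_bot.2 hinj)
  let K : F →L[ℝ] (ι → ℝ) := LinearMap.toContinuousLinearMap K₀
  let T : ℝ → (ι → ℝ) →L[ℝ] (ι → ℝ) := fun t => K.comp (A t)
  have hT : ContDiffAt ℝ ∞ T t₀ := contDiffAt_const.clm_comp hAs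
  have hT₀ : T t₀ = (ContinuousLinearEquiv.refl ℝ (ι → ℝ) : (ι → ℝ) →L[ℝ] (ι → ℝ)) := by
    ext1 c
    exact DFunLike.congr_fun hK₀ c
  have hev : ∀ᶠ t in 𝓝 t₀, ∃ u : (ι → ℝ) ≃L[ℝ] (ι → ℝ), (u : (ι → ℝ) →L[ℝ] (ι → ℝ)) = T t := by
    have := hT.continuousAt.eventually
      (hT₀ ▸ ContinuousLinearEquiv.nhds (ContinuousLinearEquiv.refl ℝ (ι → ℝ)))
    exact this
  have hI : ContDiffAt ℝ ∞ (fun t => (T t).inverse) t₀ :=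
    ContDiffAt.comp (g := ContinuousLinearMap.inverse) t₀
      (hT₀ ▸ contDiffAt_map_inverse (ContinuousLinearEquiv.refl ℝ (ι → ℝ))) hT
  refine (hI.clm_apply (contDiffAt_const.clm_apply hb : ContDiffAt ℝ ∞ (fun t => K (b t)) t₀)
    ).congr_of_eventuallyEq ?_
  filter_upwards [hev, hμ] with t ⟨u, hu⟩ ht
  have h1 : K (b t) = u (μ t) := by
    rw [ht, ← hA]
    exact (DFunLike.congr_fun hu (μ t)).symm
  rw [← hu, ContinuousLinearMap.inverse_equiv, h1]
  simp

/-- Rows that are linearly independent define a surjective map. -/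
theorem surjective_of_linearIndependent {ι F : Type*} [Fintype ι] [AddCommGroup F] [Module ℝ F]
    {f : F →ₗ[ℝ] ι → ℝ}
    (h : LinearIndependent ℝ fun a => (LinearMap.proj a : (ι → ℝ) →ₗ[ℝ] ℝ) ∘ₗ f) :
    Function.Surjective f := by
  classical
  rw [← LinearMap.range_eq_top]
  by_contra hne
  -- A nonzero functional vanishing on a proper range has coefficients that form a linear relation
  -- among the rows.
  obtain ⟨g, hg, hle⟩ := Submodule.exists_le_ker_of_lt_top _ (lt_top_iff_ne_top.2 hne)
  apply hg
  have hgs : ∀ c, g c = ∑ a, g (Pi.single a 1) * c a := fun c => by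
    conv_lhs => rw [← Finset.univ_sum_single c, map_sum]
    refine Finset.sum_congr rfl fun a _ => ?_
    have : (Pi.single a (c a) : ι → ℝ) = c a • Pi.single a 1 := by
      rw [← Pi.single_smul]; simp
    rw [this, map_smul, smul_eq_mul, mul_comm]
  have h0 := Fintype.linearIndependent_iff.1 h (fun a => g (Pi.single a 1)) (by
    ext x
    have h1 : g (f x) = 0 := hle ⟨x, rfl⟩
    rw [hgs] at h1
    simpa [LinearMap.sum_apply] using h1)
  ext a
  simpa using h0 a

/-! ### The presymplectic section and the differentials in coordinates -/

section System

variable {m n k : ℕ} (B : TrivAlgebroid (X m) (Y n))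

/-- The Liouville section is linear in the momentum and independent of the base point, so its
derivative is a constant linear map. Only the momentum components are differentiated, and the
bracket contributes the remaining term. -/
theorem canonicalForm_apply {V F : Type*} [NormedAddCommGroup V] [NormedSpace ℝ V]
    [NormedAddCommGroup F] [NormedSpace ℝ F] (B : TrivAlgebroid V F) (q : V × (F →L[ℝ] ℝ))
    (a b : F × (F →L[ℝ] ℝ)) :
    B.canonicalForm q a b = b.2 a.1 - a.2 b.1 + q.2 (B.str q.1 a.1 b.1) := by
  have hl : fderiv ℝ (TrivAlgebroid.liouville V F) q =
      ((ContinuousLinearMap.compL ℝ (F × (F →L[ℝ] ℝ)) F ℝ).flip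
        (ContinuousLinearMap.fst ℝ F (F →L[ℝ] ℝ))).comp
        (ContinuousLinearMap.snd ℝ V (F →L[ℝ] ℝ)) :=
    ContinuousLinearMap.fderiv (((ContinuousLinearMap.compL ℝ (F × (F →L[ℝ] ℝ)) F ℝ).flip
        (ContinuousLinearMap.fst ℝ F (F →L[ℝ] ℝ))).comp
        (ContinuousLinearMap.snd ℝ V (F →L[ℝ] ℝ)))
  simp only [TrivAlgebroid.canonicalForm, TrivAlgebroid.dOne, LinearMap.neg_apply,
    LinearMap.sub_apply, LinearMap.flip_apply, LinearMap.comp_apply, hl]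
  simp [TrivAlgebroid.prolong, TrivAlgebroid.liouville]
  ring

theorem contDiff_π₁ : ContDiff ℝ ∞ (π₁ : W m n → E2 m n) :=
  contDiff_fst.prodMk (contDiff_fst.comp contDiff_snd)

theorem hasFDerivAt_π₁ (w : W m n) : HasFDerivAt (π₁ : W m n → E2 m n)
    ((ContinuousLinearMap.fst ℝ (X m × Y n) (Y n × P n)).prod
      ((ContinuousLinearMap.fst ℝ _ _).comp (ContinuousLinearMap.snd ℝ _ _))) w :=
  ContinuousLinearMap.hasFDerivAt
    ((ContinuousLinearMap.fst ℝ (X m × Y n) (Y n × P n)).prod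
      ((ContinuousLinearMap.fst ℝ _ _).comp (ContinuousLinearMap.snd ℝ _ _)))

/-- The `z` components `Z.2.1` and `Z'.2.1` drop out, since π₂ forgets `z`: this degeneracy is what
turns the `z` part of the equation into the constraint p̄_A = ∂L̃/∂z^A. -/
theorem Omega0_apply (w : W m n) (Z Z' : TW n) :
    Omega0 B w Z Z' = Z'.2.2 Z.1 - Z.2.2 Z'.1 + w.2.2 (B.str w.1.1 Z.1.1 Z'.1.1, 0) := by
  simp only [Omega0, LinearMap.compl₁₂_apply, canonicalForm_apply]
  simp [tangentE, TrivAlgebroid.prolong]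

theorem tangentW_anchor (w : W m n) (Z : TW n) :
    (tangentW B).anchor w Z = ((B.anchor w.1.1 Z.1.1, Z.1.2), Z.2) := rfl

theorem differentiableAt_pontryagin {L : E2 m n → ℝ} {w : W m n}
    (hL : DifferentiableAt ℝ L (π₁ w)) : DifferentiableAt ℝ (pontryagin L) w := by
  have h : DifferentiableAt ℝ (fun w' => L (π₁ w')) w :=
    hL.comp w (hasFDerivAt_π₁ w).differentiableAt
  have h1 : DifferentiableAt ℝ (fun w' : W m n => w'.2.2) w := differentiableAt_snd.snd
  have h2 : DifferentiableAt ℝ (fun w' : W m n => (w'.1.2, w'.2.1)) w :=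
    differentiableAt_fst.snd.prodMk differentiableAt_snd.fst
  exact (h1.clm_apply h2).sub h

theorem dFun_pontryagin {L : E2 m n → ℝ} {w : W m n} (hL : DifferentiableAt ℝ L (π₁ w))
    (Z : TW n) :
    (tangentW B).dFun (pontryagin L) w Z = Z.2.2 (w.1.2, w.2.1) + w.2.2 (Z.1.2, Z.2.1) -
      fderiv ℝ L (π₁ w) ((B.anchor w.1.1 Z.1.1, Z.1.2), Z.2.1) := by
  have h1 : HasFDerivAt (fun w' : W m n => w'.2.2)
      ((ContinuousLinearMap.snd ℝ (Y n) (P n)).comp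
        (ContinuousLinearMap.snd ℝ (X m × Y n) (Y n × P n))) w :=
    ((ContinuousLinearMap.snd ℝ (Y n) (P n)).comp
        (ContinuousLinearMap.snd ℝ (X m × Y n) (Y n × P n))).hasFDerivAt
  have h2 : HasFDerivAt (fun w' : W m n => (w'.1.2, w'.2.1))
      (((ContinuousLinearMap.snd ℝ (X m) (Y n)).comp
        (ContinuousLinearMap.fst ℝ (X m × Y n) (Y n × P n))).prod
        ((ContinuousLinearMap.fst ℝ (Y n) (P n)).comp
        (ContinuousLinearMap.snd ℝ (X m × Y n) (Y n × P n)))) w :=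
    (((ContinuousLinearMap.snd ℝ (X m) (Y n)).comp
        (ContinuousLinearMap.fst ℝ (X m × Y n) (Y n × P n))).prod
        ((ContinuousLinearMap.fst ℝ (Y n) (P n)).comp
        (ContinuousLinearMap.snd ℝ (X m × Y n) (Y n × P n)))).hasFDerivAt
  have h3 : HasFDerivAt (pontryagin L) _ w := (h1.clm_apply h2).sub
    (hL.hasFDerivAt.comp w (hasFDerivAt_π₁ w))
  simp only [TrivAlgebroid.dFun, h3.fderiv, LinearMap.comp_apply, tangentW_anchor]
  simp
  ring

theorem dConstraint_apply {Φ : Fin k → E2 m n → ℝ} {a : Fin k} {w : W m n}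
    (h : DifferentiableAt ℝ (Φ a) (π₁ w)) (Z : TW n) :
    dConstraint B Φ a w Z =
      fderiv ℝ (Φ a) (π₁ w) ((B.anchor w.1.1 Z.1.1, Z.1.2), Z.2.1) := by
  have h3 : HasFDerivAt (fun w' : W m n => Φ a (π₁ w')) _ w := h.hasFDerivAt.comp w (hasFDerivAt_π₁ w)
  simp only [dConstraint, TrivAlgebroid.dFun, h3.fderiv, LinearMap.comp_apply, tangentW_anchor]
  simp

theorem defect_apply {L : E2 m n → ℝ} {w : W m n} (hL : DifferentiableAt ℝ L (π₁ w))
    (Z Z' : TW n) :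
    defect B L w Z Z' = Z'.2.2 Z.1 - Z.2.2 Z'.1 + w.2.2 (B.str w.1.1 Z.1.1 Z'.1.1, 0) -
      (Z'.2.2 (w.1.2, w.2.1) + w.2.2 (Z'.1.2, Z'.2.1) -
      fderiv ℝ L (π₁ w) ((B.anchor w.1.1 Z'.1.1, Z'.1.2), Z'.2.1)) := by
  rw [defect, LinearMap.sub_apply, Omega0_apply, dFun_pontryagin B hL Z']

end System

/-! ### The presymplectic system and the multipliers -/

section Constraint

variable {m n k : ℕ} (B : TrivAlgebroid (X m) (Y n))

theorem linearMap_apply_eq_sum {F : Type*} [AddCommGroup F] [Module ℝ F] (f : Y n →ₗ[ℝ] F)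
    (u : Y n) : f u = ∑ A, u A • f (Pi.single A 1) := by
  conv_lhs => rw [pi_eq_sum_univ' u, map_sum]
  simp

theorem forall_eq_iff_single (f g : Y n →ₗ[ℝ] ℝ) :
    (∀ u, f u = g u) ↔ ∀ A, f (Pi.single A 1) = g (Pi.single A 1) :=
  ⟨fun h A => h _, fun h u => by
    rw [linearMap_apply_eq_sum f, linearMap_apply_eq_sum g]; simp [h]⟩

variable {D N : Set (E2 m n)} (hD : IsOpen D) {Φ : Fin k → E2 m n → ℝ}
  (hΦ : ∀ a, ContDiffOn ℝ ∞ (Φ a) D) (hN : ∀ ξ ∈ D, ξ ∈ N ↔ ∀ a, Φ a ξ = 0)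
  (hrank : ∀ ξ ∈ D, (∀ a, Φ a ξ = 0) →
      LinearIndependent ℝ (fun (a : Fin k) (b : Fin n) => pdz (Φ a) b ξ))

theorem differentiableAt_of_contDiffOn {V G : Type*} [NormedAddCommGroup V] [NormedSpace ℝ V]
    [NormedAddCommGroup G] [NormedSpace ℝ G] {f : V → G} {U : Set V} (hU : IsOpen U)
    (hf : ContDiffOn ℝ ∞ f U) {x : V} (hx : x ∈ U) : DifferentiableAt ℝ f x :=
  (hf.contDiffAt (hU.mem_nhds hx)).differentiableAt (by simp)

include hD hΦ hN hrank in
/-- The tangent space of `W̄₀` is the kernel of the differentials of the constraints. -/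
theorem mem_tangentSub_iff {w : W m n} (hw : w ∈ Wbar D N) (Z : TW n) :
    Z ∈ tangentSub B (Wbar D N) w ↔ ∀ a, dConstraint B Φ a w Z = 0 := by
  have hcd : ∀ a, ContDiffAt ℝ ∞ (Φ a) (π₁ w) := fun a =>
    (hΦ a).contDiffAt (hD.mem_nhds hw.1)
  have hdiff : ∀ a, DifferentiableAt ℝ (Φ a) (π₁ w) := fun a =>
    (hcd a).differentiableAt (by simp)
  have hzero : ∀ a, Φ a (π₁ w) = 0 := (hN _ hw.1).1 hw.2
  let F : W m n → Fin k → ℝ := fun w' a => Φ a (π₁ w')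
  have hF : ContDiffAt ℝ ∞ F w :=
    contDiffAt_pi.2 fun a => (hcd a).comp w contDiff_π₁.contDiffAt
  have hFd : HasFDerivAt F _ w :=
    hasFDerivAt_pi.2 fun a => (hdiff a).hasFDerivAt.comp w (hasFDerivAt_π₁ w)
  have hFa : ∀ v a, fderiv ℝ F w v a = fderiv ℝ (Φ a) (π₁ w) (v.1, v.2.1) := fun v a => by
    rw [hFd.fderiv]; rfl
  constructor
  · rintro ⟨c, -, hc0, hcS, hcd⟩ a
    rw [dConstraint_apply B (hdiff a)]
    refine (hFa ((tangentW B).anchor w Z) a).symm.trans ?_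
    have h1 : HasDerivAt (F ∘ c) (fderiv ℝ F w ((tangentW B).anchor w Z)) 0 := by
      refine HasFDerivAt.comp_hasDerivAt (0 : ℝ) ?_ hcd
      rw [hc0]
      exact (hF.differentiableAt (by simp)).hasFDerivAt
    have h2 : F ∘ c =ᶠ[𝓝 0] fun _ => 0 := by
      filter_upwards [hcS] with t ht
      exact funext fun a => (hN _ ht.1).1 ht.2 a
    have h3 := (h1.congr_of_eventuallyEq h2.symm).unique (hasDerivAt_const (0 : ℝ) (0 : Fin k → ℝ))
    rw [h3]; rfl
  · intro h
    have hsurj : Function.Surjective (fderiv ℝ F w) := by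
      refine surjective_of_linearIndependent (f := (fderiv ℝ F w : W m n →ₗ[ℝ] Fin k → ℝ)) ?_
      have hli := hrank _ hw.1 hzero
      rw [Fintype.linearIndependent_iff] at hli ⊢
      intro g hg
      refine hli g (funext fun b => ?_)
      -- On a pure `z` direction the relation involves only ∂Φ/∂z^b, to which the rank hypothesis
      -- applies.
      have h1 := DFunLike.congr_fun hg (((0, 0), (Pi.single b 1, 0)) : W m n)
      simp only [LinearMap.sum_apply, LinearMap.smul_apply, LinearMap.comp_apply,
        LinearMap.proj_apply, ContinuousLinearMap.coe_coe, hFa] at h1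
      simpa [pdz] using h1
    have hv : fderiv ℝ F w ((tangentW B).anchor w Z) = 0 := by
      ext a
      rw [hFa]
      have := h a
      rw [dConstraint_apply B (hdiff a)] at this
      exact this
    obtain ⟨c, hcs, hc0, hcF, hcd⟩ := exists_curve_of_fderiv_apply_eq_zero hF hsurj hv
    refine ⟨c, hcs, hc0, ?_, hcd⟩
    -- The vanishing of the Φ^α describes 𝓜 only inside `D`, so the curve must also be kept in `D`,
    -- which is open.
    have hD' : ∀ᶠ t in 𝓝 (0 : ℝ), π₁ (c t) ∈ D :=
      (contDiff_π₁.continuous.continuousAt.comp hcs.continuousAt).eventually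
        (hD.mem_nhds (by simpa [hc0] using hw.1))
    filter_upwards [hcF, hD'] with t ht htD
    refine ⟨htD, (hN _ htD).2 fun a => ?_⟩
    have := congrFun ht a
    exact this.trans (hzero a)

include hD hΦ hN hrank in
/-- The annihilator of the tangent space of `W̄₀` is spanned by the differentials of the
constraints. -/
theorem ann_eq_span {w : W m n} (hw : w ∈ Wbar D N) : ann B (Wbar D N) w =
    (Submodule.span ℝ (Set.range fun a => dConstraint B Φ a w) : Set (TW n →ₗ[ℝ] ℝ)) := by
  ext θ
  constructor
  · intro h
    -- A functional that vanishes on the common kernel of finitely many functionals is a combination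
    -- of them.
    refine mem_span_of_iInf_ker_le_ker fun Z hZ => ?_
    rw [LinearMap.mem_ker]
    refine h Z ((mem_tangentSub_iff B hD hΦ hN hrank hw Z).2 fun a => ?_)
    exact (Submodule.mem_iInf _).1 hZ a
  · intro h Z hZ
    have hle : Submodule.span ℝ (Set.range fun a => dConstraint B Φ a w) ≤
        LinearMap.ker (LinearMap.applyₗ Z : (TW n →ₗ[ℝ] ℝ) →ₗ[ℝ] ℝ) := by
      rw [Submodule.span_le]
      rintro _ ⟨a, rfl⟩
      exact (mem_tangentSub_iff B hD hΦ hN hrank hw Z).1 hZ a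
    exact hle h

/-- The presymplectic equation in extrinsic form. -/
theorem intrinsicEq_iff {S : Set (W m n)} {H : W m n → ℝ} {L : E2 m n → ℝ}
    (hH : ∀ w ∈ S, H w = pontryagin L w) {w : W m n} (hL : DifferentiableAt ℝ L (π₁ w))
    (Z : TW n) :
    IntrinsicEq B S H w Z ↔ defect B L w Z ∈ ann B S w ∧ Z ∈ tangentSub B S w := by
  -- Along a curve in `S` the function `H` agrees near time 0 with the differentiable function
  -- `pontryagin L`, so the derivative depends only on the velocity. Every element of `tangentSub`
  -- comes with such a curve, and uniqueness of derivatives then compares the two equations.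
  have key : ∀ Z' (c : ℝ → W m n), c 0 = w → (∀ᶠ t in 𝓝 0, c t ∈ S) →
      HasDerivAt c ((tangentW B).anchor w Z') 0 →
      HasDerivAt (fun t => H (c t)) ((tangentW B).dFun (pontryagin L) w Z') 0 := by
    intro Z' c hc0 hcS hcd
    have h1 : HasDerivAt (fun t => pontryagin L (c t))
        ((tangentW B).dFun (pontryagin L) w Z') 0 := by
      refine HasFDerivAt.comp_hasDerivAt (l := pontryagin L)
        (l' := fderiv ℝ (pontryagin L) w) (0 : ℝ) ?_ hcd
      rw [hc0]
      exact (differentiableAt_pontryagin hL).hasFDerivAt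
    exact h1.congr_of_eventuallyEq (hcS.mono fun t ht => hH _ ht)
  constructor
  · rintro ⟨hZ, h⟩
    refine ⟨fun Z' hZ' => ?_, hZ⟩
    obtain ⟨c, hcs, hc0, hcS, hcd⟩ := id hZ'
    have := (h Z' hZ' c hcs hc0 hcS hcd).unique (key Z' c hc0 hcS hcd)
    rw [defect, LinearMap.sub_apply, this, sub_self]
  · rintro ⟨h, hZ⟩
    refine ⟨hZ, fun Z' hZ' c hcs hc0 hcS hcd => ?_⟩
    have h1 := h Z' hZ'
    rw [defect, LinearMap.sub_apply, sub_eq_zero] at h1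
    rw [h1]
    exact key Z' c hc0 hcS hcd

theorem contDiffOn_fderiv_apply_comp {f : E2 m n → ℝ} (hD : IsOpen D) (hf : ContDiffOn ℝ ∞ f D)
    {I : Set ℝ} {ξ : ℝ → E2 m n} (hξ : ContDiffOn ℝ ∞ ξ I) (hξD : ∀ t ∈ I, ξ t ∈ D)
    (v : E2 m n) : ContDiffOn ℝ ∞ (fun t => fderiv ℝ f (ξ t) v) I :=
  ((hf.fderiv_of_isOpen hD (m := ∞) (by simp)).comp hξ hξD).clm_apply contDiffOn_const

include hD hΦ hN hrank in
/-- The multipliers along a smooth curve in `W̄₀` are smooth. -/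
theorem contDiffOn_multipliers {L : E2 m n → ℝ} (hL : ContDiffOn ℝ ∞ L D) {I : Set ℝ}
    (hI : IsOpen I) {w : ℝ → W m n} (hw : ContDiffOn ℝ ∞ w I) {μ : ℝ → Fin k → ℝ}
    (h : SolvesExtrinsic B (Wbar D N) L Φ I w μ) : ContDiffOn ℝ ∞ μ I := by
  have hξ : ContDiffOn ℝ ∞ (fun t => π₁ (w t)) I := contDiff_π₁.comp_contDiffOn hw
  have hξD : ∀ t ∈ I, π₁ (w t) ∈ D := fun t ht => (h t ht).1.1
  intro t₀ ht₀
  have hnhds := hI.mem_nhds ht₀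
  -- The `z` components of the equation read ∂L/∂z^b - p̄_b = μ_α ∂Φ^α/∂z^b; they contain no
  -- component of the solution `Z`, and they determine μ.
  refine (contDiffAt_coeff_of_linearIndependent
    (g := fun a t => (fun b => pdz (Φ a) b (π₁ (w t)) : Y n))
    (b := fun t => (fun b => pdz L b (π₁ (w t)) - (w t).2.2 (0, Pi.single b 1) : Y n))
    (fun a => contDiffAt_pi.2 fun b =>
      (contDiffOn_fderiv_apply_comp hD (hΦ a) hξ hξD _).contDiffAt hnhds)
    (contDiffAt_pi.2 fun b =>
      ((contDiffOn_fderiv_apply_comp hD hL hξ hξD _).contDiffAt hnhds).sub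
        ((contDiffAt_snd.snd.comp t₀ (hw.contDiffAt hnhds)).clm_apply contDiffAt_const))
    (hrank _ (hξD t₀ ht₀) ((hN _ (hξD t₀ ht₀)).1 (h t₀ ht₀).1.2)) ?_).contDiffWithinAt
  filter_upwards [hnhds] with t ht
  obtain ⟨-, Z, -, -, hZ⟩ := h t ht
  ext b
  have h1 := DFunLike.congr_fun hZ (((0, 0), (Pi.single b 1, 0)) : TW n)
  rw [defect_apply B (differentiableAt_of_contDiffOn hD hL (hξD t ht))] at h1
  simp only [LinearMap.sum_apply, LinearMap.smul_apply] at h1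
  simp only [fun a => dConstraint_apply B
    (differentiableAt_of_contDiffOn hD (hΦ a) (hξD t ht))] at h1
  have h00 : ((0, 0) : Y n × Y n) = 0 := rfl
  simp [h00] at h1
  simp only [Finset.sum_apply, Pi.smul_apply, smul_eq_mul, pdz]
  linarith

include hD hΦ hN hrank in
/-- Integral curves of the presymplectic system are those of the system with multipliers. -/
theorem solvesIntrinsic_iff {H : W m n → ℝ} {L : E2 m n → ℝ}
    (hH : ∀ w ∈ Wbar D N, H w = pontryagin L w) (hL : ContDiffOn ℝ ∞ L D) {I : Set ℝ}
    (hI : IsOpen I) {w : ℝ → W m n} (hw : ContDiffOn ℝ ∞ w I) :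
    SolvesIntrinsic B (Wbar D N) H I w ↔
      ∃ μ : ℝ → Fin k → ℝ, ContDiffOn ℝ ∞ μ I ∧ SolvesExtrinsic B (Wbar D N) L Φ I w μ := by
  constructor
  · intro h
    have hex : ∀ t, ∃ μ : Fin k → ℝ, t ∈ I → ∃ Z : TW n,
        HasDerivAt w ((tangentW B).anchor (w t) Z) t ∧ Z ∈ tangentSub B (Wbar D N) (w t) ∧
        defect B L (w t) Z = ∑ a, μ a • dConstraint B Φ a (w t) := by
      intro t
      by_cases ht : t ∈ I
      · obtain ⟨hS, Z, hd, hZ⟩ := h t ht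
        obtain ⟨h1, h2⟩ := (intrinsicEq_iff B hH (differentiableAt_of_contDiffOn hD hL hS.1) Z).1 hZ
        rw [ann_eq_span B hD hΦ hN hrank hS] at h1
        obtain ⟨μ, hμ⟩ := (Submodule.mem_span_range_iff_exists_fun ℝ).1 h1
        exact ⟨μ, fun _ => ⟨Z, hd, h2, hμ.symm⟩⟩
      · exact ⟨0, fun h => (ht h).elim⟩
    -- The choice is made pointwise, with no regularity; since the multipliers are unique at each
    -- point of `I`, any choice is smooth there.
    choose μ hμ using hex
    have hs : SolvesExtrinsic B (Wbar D N) L Φ I w μ := fun t ht => ⟨(h t ht).1, hμ t ht⟩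
    exact ⟨μ, contDiffOn_multipliers B hD hΦ hN hrank hL hI hw hs, hs⟩
  · rintro ⟨μ, -, h⟩ t ht
    obtain ⟨hS, Z, hd, hZ, heq⟩ := h t ht
    refine ⟨hS, Z, hd,
      (intrinsicEq_iff B hH (differentiableAt_of_contDiffOn hD hL hS.1) Z).2 ⟨?_, hZ⟩⟩
    rw [ann_eq_span B hD hΦ hN hrank hS, heq]
    exact (Submodule.mem_span_range_iff_exists_fun ℝ).2 ⟨μ t, rfl⟩

end Constraint

/-! ### The second-order Euler–Lagrange equations -/

section EulerLagrangeEquiv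

variable {m n k : ℕ} (B : TrivAlgebroid (X m) (Y n))

theorem fderiv_augmented {L : E2 m n → ℝ} {Φ : Fin k → E2 m n → ℝ} {ξ : E2 m n}
    (hL : DifferentiableAt ℝ L ξ) (hΦ : ∀ a, DifferentiableAt ℝ (Φ a) ξ) (l : Fin k → ℝ)
    (v : E2 m n) :
    fderiv ℝ (augmented L Φ l) ξ v = fderiv ℝ L ξ v + ∑ a, l a * fderiv ℝ (Φ a) ξ v := by
  have h : HasFDerivAt (augmented L Φ l) (fderiv ℝ L ξ + ∑ a, l a • fderiv ℝ (Φ a) ξ) ξ :=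
    hL.hasFDerivAt.add (HasFDerivAt.fun_sum fun a _ => (hΦ a).hasFDerivAt.const_mul (l a))
  rw [h.fderiv]
  simp

/-- The equation `i_X Ω₀ - dH = -λ_α dΦ^α` in coordinates. -/
theorem defect_eq_iff {L : E2 m n → ℝ} {Φ : Fin k → E2 m n → ℝ} {w : W m n}
    (hL : DifferentiableAt ℝ L (π₁ w)) (hΦ : ∀ a, DifferentiableAt ℝ (Φ a) (π₁ w))
    (l : Fin k → ℝ) (Z : TW n) :
    defect B L w Z = ∑ a, (-l) a • dConstraint B Φ a w ↔
      Z.1 = (w.1.2, w.2.1) ∧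
      (∀ A, w.2.2 (0, Pi.single A 1) = pdz (augmented L Φ l) A (π₁ w)) ∧
      (∀ A, Z.2.2 (0, Pi.single A 1) =
        pdy (augmented L Φ l) A (π₁ w) - w.2.2 (Pi.single A 1, 0)) ∧
      (∀ A, Z.2.2 (Pi.single A 1, 0) = w.2.2 (B.str w.1.1 Z.1.1 (Pi.single A 1), 0) +
        fderiv ℝ (augmented L Φ l) (π₁ w) ((B.anchor w.1.1 (Pi.single A 1), 0), 0)) := by
  set G := fderiv ℝ (augmented L Φ l) (π₁ w)
  -- The test vector is split into its independent components `(f, g)`, `ζ` and `β`; setting all but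
  -- one to zero isolates each coordinate equation.
  have hmain : defect B L w Z = ∑ a, (-l) a • dConstraint B Φ a w ↔
      ∀ (f g ζ : Y n) (β : P n), β (Z.1 - (w.1.2, w.2.1)) - Z.2.2 (f, g) +
        w.2.2 (B.str w.1.1 Z.1.1 f, 0) - w.2.2 (g, ζ) + G ((B.anchor w.1.1 f, g), ζ) = 0 := by
    rw [LinearMap.ext_iff]
    have : ∀ Z' : TW n, (defect B L w Z Z' = (∑ a, (-l) a • dConstraint B Φ a w) Z' ↔
        Z'.2.2 (Z.1 - (w.1.2, w.2.1)) - Z.2.2 Z'.1 +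
        w.2.2 (B.str w.1.1 Z.1.1 Z'.1.1, 0) - w.2.2 (Z'.1.2, Z'.2.1) +
        G ((B.anchor w.1.1 Z'.1.1, Z'.1.2), Z'.2.1) = 0) := by
      intro Z'
      have hG := fderiv_augmented hL hΦ l ((B.anchor w.1.1 Z'.1.1, Z'.1.2), Z'.2.1)
      rw [defect_apply B hL]
      simp only [LinearMap.sum_apply, LinearMap.smul_apply, dConstraint_apply B (hΦ _),
        Pi.neg_apply, smul_eq_mul, neg_mul, Finset.sum_neg_distrib, map_sub]
      rw [show G _ = _ from hG]
      constructor <;> intro h <;> linarith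
    exact ⟨fun h f g ζ β => (this ((f, g), (ζ, β))).1 (h _),
      fun h Z' => (this Z').2 (h Z'.1.1 Z'.1.2 Z'.2.1 Z'.2.2)⟩
  rw [hmain]
  have h00 : ((0, 0) : Y n × Y n) = 0 := rfl
  have h00' : ((0, 0) : X m × Y n) = 0 := rfl
  have h000 : ((0, 0) : E2 m n) = 0 := rfl
  constructor
  · intro h
    refine ⟨?_, fun A => ?_, fun A => ?_, fun A => ?_⟩
    · rw [← sub_eq_zero]
      refine SeparatingDual.eq_zero_of_forall_dual_eq_zero (R := ℝ) fun β => ?_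
      simpa [h00, h00', h000] using h 0 0 0 β
    · have := h 0 0 (Pi.single A 1) 0
      simp only [map_zero, zero_apply, h00] at this
      change _ = G _
      linarith
    · have := h 0 (Pi.single A 1) 0 0
      simp only [map_zero, zero_apply, h00] at this
      change _ = G _ - _
      linarith
    · have := h (Pi.single A 1) 0 0 0
      simp only [map_zero, zero_apply, h00] at this
      linarith
  · rintro ⟨h1, h2, h3, h4⟩ f g ζ β
    have h2' : ∀ ζ : Y n, w.2.2 (0, ζ) = G (0, ζ) :=
      (forall_eq_iff_single ((w.2.2 : Y n × Y n →ₗ[ℝ] ℝ) ∘ₗ LinearMap.inr ℝ _ _)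
        ((G : E2 m n →ₗ[ℝ] ℝ) ∘ₗ LinearMap.inr ℝ _ _)).2 h2
    have h3' : ∀ g : Y n, Z.2.2 (0, g) = G ((0, g), 0) - w.2.2 (g, 0) :=
      (forall_eq_iff_single ((Z.2.2 : Y n × Y n →ₗ[ℝ] ℝ) ∘ₗ LinearMap.inr ℝ _ _)
        ((G : E2 m n →ₗ[ℝ] ℝ) ∘ₗ LinearMap.inl ℝ _ _ ∘ₗ LinearMap.inr ℝ _ _ -
          (w.2.2 : Y n × Y n →ₗ[ℝ] ℝ) ∘ₗ LinearMap.inl ℝ _ _)).2 h3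
    have h4' : ∀ f : Y n, Z.2.2 (f, 0) = w.2.2 (B.str w.1.1 Z.1.1 f, 0) +
        G ((B.anchor w.1.1 f, 0), 0) :=
      (forall_eq_iff_single ((Z.2.2 : Y n × Y n →ₗ[ℝ] ℝ) ∘ₗ LinearMap.inl ℝ _ _)
        ((w.2.2 : Y n × Y n →ₗ[ℝ] ℝ) ∘ₗ LinearMap.inl ℝ _ _ ∘ₗ B.str w.1.1 Z.1.1 +
          (G : E2 m n →ₗ[ℝ] ℝ) ∘ₗ LinearMap.inl ℝ _ _ ∘ₗ LinearMap.inl ℝ _ _ ∘ₗ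
            B.anchor w.1.1)).2 h4
    have e1 : Z.2.2 (f, g) = Z.2.2 (f, 0) + Z.2.2 (0, g) := by rw [← map_add]; simp
    have e2 : w.2.2 (g, ζ) = w.2.2 (g, 0) + w.2.2 (0, ζ) := by rw [← map_add]; simp
    have e3 : G ((B.anchor w.1.1 f, g), ζ) =
        G ((B.anchor w.1.1 f, 0), 0) + G ((0, g), 0) + G (0, ζ) := by
      rw [← map_add, ← map_add]; simp
    rw [h1, sub_self, map_zero, e1, e2, e3, h2', h3', ← h1, h4']
    ring

variable {D N : Set (E2 m n)} (hD : IsOpen D) {Φ : Fin k → E2 m n → ℝ}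
  (hΦ : ∀ a, ContDiffOn ℝ ∞ (Φ a) D) (hN : ∀ ξ ∈ D, ξ ∈ N ↔ ∀ a, Φ a ξ = 0)

include hD hΦ in
theorem contDiffOn_fderiv_augmented {L : E2 m n → ℝ} (hL : ContDiffOn ℝ ∞ L D) {I : Set ℝ}
    {ξ : ℝ → E2 m n} (hξ : ContDiffOn ℝ ∞ ξ I) (hξD : ∀ t ∈ I, ξ t ∈ D) {l : ℝ → Fin k → ℝ}
    (hl : ContDiffOn ℝ ∞ l I) (v : E2 m n) :
    ContDiffOn ℝ ∞ (fun t => fderiv ℝ (augmented L Φ (l t)) (ξ t) v) I := by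
  have h : ContDiffOn ℝ ∞
      (fun t => fderiv ℝ L (ξ t) v + ∑ a, l t a * fderiv ℝ (Φ a) (ξ t) v) I :=
    (contDiffOn_fderiv_apply_comp hD hL hξ hξD v).add <| ContDiffOn.sum fun a _ =>
      (contDiffOn_pi.1 hl a).mul (contDiffOn_fderiv_apply_comp hD (hΦ a) hξ hξD v)
  exact h.congr fun t ht => fderiv_augmented (differentiableAt_of_contDiffOn hD hL (hξD t ht))
    (fun a => differentiableAt_of_contDiffOn hD (hΦ a) (hξD t ht)) _ _

/-- The velocity at `t` of a smooth curve in `S` is a velocity of `S`. -/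
theorem mem_velocities_of_hasDerivAt {V : Type*} [NormedAddCommGroup V] [NormedSpace ℝ V]
    {S : Set V} {I : Set ℝ} (hI : IsOpen I) {w : ℝ → V} (hw : ContDiffOn ℝ ∞ w I)
    (hS : ∀ t ∈ I, w t ∈ S) {t : ℝ} (ht : t ∈ I) {v : V} (hv : HasDerivAt w v t) :
    v ∈ velocities S (w t) := by
  refine ⟨fun s => w (t + s), ?_, by simp, ?_, ?_⟩
  · refine ContDiffAt.comp (g := w) (0 : ℝ) ?_ (contDiffAt_const.add contDiffAt_id)
    simpa using hw.contDiffAt (hI.mem_nhds ht)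
  · have h : Filter.Tendsto (fun s : ℝ => t + s) (𝓝 0) (𝓝 t) := by
      have : Continuous fun s : ℝ => t + s := by fun_prop
      simpa using this.tendsto 0
    exact (h.eventually (hI.mem_nhds ht)).mono fun s hs => hS _ hs
  · exact HasDerivAt.comp_const_add t 0 (by simpa using hv)

variable {rho : Fin n → Fin m → X m → ℝ} {C : Fin n → Fin n → Fin n → X m → ℝ}
  (hanch : ∀ x u, B.anchor x u = ∑ a, u a • ∑ i, rho a i x • EuclideanSpace.single i (1 : ℝ))
  (hstr : ∀ x u v d, B.str x u v d = ∑ a, ∑ b, C a b d x * (u a * v b))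
  (hC : ∀ a b d x, C a b d x = -C b a d x)

include hanch in
theorem anchor_apply (x : X m) (u : Y n) (i : Fin m) :
    B.anchor x u i = ∑ a, rho a i x * u a := by
  rw [hanch]
  simp [Finset.sum_apply, Pi.single_apply, mul_comm]

include hanch in
theorem fderiv_anchor_single (f : E2 m n → ℝ) (ξ : E2 m n) (A : Fin n) (x : X m) :
    fderiv ℝ f ξ ((B.anchor x (Pi.single A 1), 0), 0) = ∑ i, rho A i x * pdx f i ξ := by
  have h : B.anchor x (Pi.single A 1) = ∑ i, rho A i x • EuclideanSpace.single i (1 : ℝ) := by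
    rw [hanch, Finset.sum_eq_single A]
    · simp
    · intro b _ hb; simp [hb]
    · simp
  have h2 : ∀ v : X m, fderiv ℝ f ξ ((v, 0), 0) = ((fderiv ℝ f ξ).comp
      ((ContinuousLinearMap.inl ℝ (X m × Y n) (Y n)).comp
        (ContinuousLinearMap.inl ℝ (X m) (Y n)))) v := fun v => rfl
  rw [h2, h, map_sum]
  simp only [map_smul, smul_eq_mul]
  rfl

include hstr hC in
-- Antisymmetry exchanges the lower indices of C_{BA}^D to match the Euler–Lagrange convention; this
-- is the source of the minus sign.
theorem momentum_str_single (α : P n) (x : X m) (y : Y n) (A : Fin n) :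
    α (B.str x y (Pi.single A 1), 0) =
      -∑ b, ∑ d, C A b d x * y b * α (Pi.single d 1, 0) := by
  have h := linearMap_apply_eq_sum ((α : Y n × Y n →ₗ[ℝ] ℝ) ∘ₗ LinearMap.inl ℝ _ _)
    (B.str x y (Pi.single A 1))
  refine h.trans ?_
  rw [Finset.sum_comm, ← Finset.sum_neg_distrib]
  refine Finset.sum_congr rfl fun d _ => ?_
  rw [hstr, ← Finset.sum_neg_distrib, Finset.sum_smul]
  refine Finset.sum_congr rfl fun b _ => ?_
  rw [Finset.sum_eq_single A]
  · rw [hC b A]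
    simp
  · intro c _ hc; simp [hc]
  · simp

include hD hΦ hN hanch hstr hC in
/-- The extrinsic system with given multipliers amounts to the constrained second-order
Euler–Lagrange equations. -/
theorem exists_solvesExtrinsic_iff {L : E2 m n → ℝ} (hL : ContDiffOn ℝ ∞ L D) {I : Set ℝ}
    (hI : IsOpen I) {ξ : ℝ → E2 m n} (hξ : ContDiffOn ℝ ∞ ξ I) (hξD : ∀ t ∈ I, ξ t ∈ D)
    {l : ℝ → Fin k → ℝ} (hl : ContDiffOn ℝ ∞ l I) :
    (∃ w : ℝ → W m n, ContDiffOn ℝ ∞ w I ∧ (∀ t ∈ I, π₁ (w t) = ξ t) ∧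
      SolvesExtrinsic B (Wbar D N) L Φ I w (fun t => -l t)) ↔
      IsEulerLagrange rho C L Φ I ξ l := by
  set Lt : ℝ → E2 m n → ℝ := fun t => augmented L Φ (l t)
  have hLd : ∀ t ∈ I, DifferentiableAt ℝ L (ξ t) := fun t ht =>
    differentiableAt_of_contDiffOn hD hL (hξD t ht)
  have hΦd : ∀ t ∈ I, ∀ a, DifferentiableAt ℝ (Φ a) (ξ t) := fun t ht a =>
    differentiableAt_of_contDiffOn hD (hΦ a) (hξD t ht)
  have hPz : ∀ A, ContDiffOn ℝ ∞ (fun s => pdz (Lt s) A (ξ s)) I := fun A =>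
    contDiffOn_fderiv_augmented hD hΦ hL hξ hξD hl _
  have hPy : ∀ A, ContDiffOn ℝ ∞ (fun s => pdy (Lt s) A (ξ s)) I := fun A =>
    contDiffOn_fderiv_augmented hD hΦ hL hξ hξD hl _
  have hPz' : ∀ A, ContDiffOn ℝ ∞ (deriv fun s => pdz (Lt s) A (ξ s)) I := fun A =>
    (hPz A).deriv_of_isOpen hI (by simp)
  constructor
  · rintro ⟨w, hw, hwξ, hs⟩ t ht
    have hx : ∀ t ∈ I, (w t).1 = (ξ t).1 := fun t ht => congrArg Prod.fst (hwξ t ht)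
    have hz : ∀ t ∈ I, (w t).2.1 = (ξ t).2 := fun t ht => congrArg Prod.snd (hwξ t ht)
    have hsys : ∀ t ∈ I, ∃ Z : TW n, HasDerivAt w ((tangentW B).anchor (w t) Z) t ∧
        Z.1 = ((ξ t).1.2, (ξ t).2) ∧
        (∀ A, (w t).2.2 (0, Pi.single A 1) = pdz (Lt t) A (ξ t)) ∧
        (∀ A, Z.2.2 (0, Pi.single A 1) = pdy (Lt t) A (ξ t) - (w t).2.2 (Pi.single A 1, 0)) ∧
        (∀ A, Z.2.2 (Pi.single A 1, 0) =
          -(∑ b, ∑ d, C A b d (ξ t).1.1 * (ξ t).1.2 b * (w t).2.2 (Pi.single d 1, 0)) +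
          ∑ i, rho A i (ξ t).1.1 * pdx (Lt t) i (ξ t)) := by
      intro t ht
      obtain ⟨-, Z, hd, -, hZ⟩ := hs t ht
      rw [defect_eq_iff B (by rw [hwξ t ht]; exact hLd t ht)
        (fun a => by rw [hwξ t ht]; exact hΦd t ht a), hwξ t ht] at hZ
      obtain ⟨h1, h2, h3, h4⟩ := hZ
      rw [hx t ht, hz t ht] at h1
      refine ⟨Z, hd, h1, h2, h3, fun A => ?_⟩
      rw [h4, momentum_str_single B hstr hC, fderiv_anchor_single B hanch, hx t ht, h1]
    have hmom : ∀ t ∈ I, ∀ Z : TW n, HasDerivAt w ((tangentW B).anchor (w t) Z) t →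
        ∀ v, HasDerivAt (fun s => (w s).2.2 v) (Z.2.2 v) t := by
      intro t ht Z hd v
      exact (ContinuousLinearMap.apply ℝ ℝ v).hasFDerivAt.comp_hasDerivAt t hd.snd.snd
    -- Since p̄_A = ∂L̃/∂z^A holds on the whole open set `I`, it may be differentiated. The
    -- resulting formula for p_A again holds on all of `I`, which permits the second differentiation
    -- in `hdd`.
    have hdPz : ∀ s ∈ I, ∀ A, deriv (fun s => pdz (Lt s) A (ξ s)) s =
        pdy (Lt s) A (ξ s) - (w s).2.2 (Pi.single A 1, 0) := by
      intro s hsI A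
      obtain ⟨Z, hd, -, -, h3, -⟩ := hsys s hsI
      rw [← h3]
      refine ((hmom s hsI Z hd _).congr_of_eventuallyEq ?_).deriv
      filter_upwards [hI.mem_nhds hsI] with r hr
      obtain ⟨-, -, -, h2, -⟩ := hsys r hr
      exact (h2 A).symm
    obtain ⟨Z, hd, h1, h2, h3, h4⟩ := hsys t ht
    have hd1 : HasDerivAt (fun s => (ξ s).1) (B.anchor (w t).1.1 Z.1.1, Z.1.2) t := by
      have h0 : HasDerivAt (fun s => (w s).1) (B.anchor (w t).1.1 Z.1.1, Z.1.2) t := hd.fst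
      refine h0.congr_of_eventuallyEq ?_
      filter_upwards [hI.mem_nhds ht] with s hs'
      exact (hx s hs').symm
    rw [hx t ht, h1] at hd1
    refine ⟨fun i => ?_, fun A => ?_, fun A => ?_, ?_⟩
    · rw [← anchor_apply B hanch]
      exact (EuclideanSpace.proj (𝕜 := ℝ) i).hasFDerivAt.comp_hasDerivAt t hd1.fst
    · exact hasDerivAt_pi.1 hd1.snd A
    · have hdd : deriv (deriv fun s => pdz (Lt s) A (ξ s)) t =
          deriv (fun s => pdy (Lt s) A (ξ s)) t - Z.2.2 (Pi.single A 1, 0) := by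
        have hy := (differentiableAt_of_contDiffOn hI (hPy A) ht).hasDerivAt
        refine ((hy.sub (hmom t ht Z hd (Pi.single A 1, 0))).congr_of_eventuallyEq ?_).deriv
        filter_upwards [hI.mem_nhds ht] with s hs'
        exact hdPz s hs' A
      change 0 = deriv (deriv fun s => pdz (Lt s) A (ξ s)) t
        + ∑ b, ∑ d, C A b d (ξ t).1.1 * (ξ t).1.2 b * deriv (fun s => pdz (Lt s) d (ξ s)) t
        - deriv (fun s => pdy (Lt s) A (ξ s)) t
        - ∑ b, ∑ d, C A b d (ξ t).1.1 * (ξ t).1.2 b * pdy (Lt t) d (ξ t)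
        + ∑ i, rho A i (ξ t).1.1 * pdx (Lt t) i (ξ t)
      rw [hdd, h4]
      simp only [hdPz t ht, mul_sub, Finset.sum_sub_distrib]
      ring
    · have hS := (hs t ht).1
      have := (hN _ hS.1).1 hS.2
      rwa [hwξ t ht] at this
  · intro h
    -- The momenta forced by the other direction: p_A = ∂L̃/∂y^A - d/dt ∂L̃/∂z^A and p̄_A =
    -- ∂L̃/∂z^A.
    let α : ℝ → P n := fun s =>
      ∑ A, ((pdy (Lt s) A (ξ s) - deriv (fun s => pdz (Lt s) A (ξ s)) s) •
        ((ContinuousLinearMap.proj (R := ℝ) (φ := fun _ : Fin n => ℝ) A).comp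
          (ContinuousLinearMap.fst ℝ (Y n) (Y n))) +
        pdz (Lt s) A (ξ s) •
        ((ContinuousLinearMap.proj (R := ℝ) (φ := fun _ : Fin n => ℝ) A).comp
          (ContinuousLinearMap.snd ℝ (Y n) (Y n))))
    have hα : ContDiffOn ℝ ∞ α I := ContDiffOn.sum fun A _ =>
      (((hPy A).sub (hPz' A)).smul contDiffOn_const).add ((hPz A).smul contDiffOn_const)
    have hα1 : ∀ s A, α s (Pi.single A 1, 0) =
        pdy (Lt s) A (ξ s) - deriv (fun s => pdz (Lt s) A (ξ s)) s := by
      intro s A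
      simp [α, Pi.single_apply]
    have hα2 : ∀ s A, α s (0, Pi.single A 1) = pdz (Lt s) A (ξ s) := by
      intro s A
      simp [α, Pi.single_apply]
    let w : ℝ → W m n := fun s => ((ξ s).1, ((ξ s).2, α s))
    have hw : ContDiffOn ℝ ∞ w I := hξ.fst.prodMk (hξ.snd.prodMk hα)
    have hwS : ∀ t ∈ I, w t ∈ Wbar D N := fun t ht =>
      ⟨hξD t ht, (hN _ (hξD t ht)).2 (h t ht).2.2.2⟩
    refine ⟨w, hw, fun t _ => rfl, fun t ht => ⟨hwS t ht, ?_⟩⟩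
    obtain ⟨e1, e2, e3, -⟩ := h t ht
    have hξ' : HasDerivAt ξ (deriv ξ t) t :=
      (differentiableAt_of_contDiffOn hI hξ ht).hasDerivAt
    have hα' : HasDerivAt α (deriv α t) t :=
      (differentiableAt_of_contDiffOn hI hα ht).hasDerivAt
    have hαv : ∀ v, HasDerivAt (fun s => α s v) (deriv α t v) t := fun v =>
      (ContinuousLinearMap.apply ℝ ℝ v).hasFDerivAt.comp_hasDerivAt t hα'
    have hξx : (deriv ξ t).1.1 = B.anchor (ξ t).1.1 (ξ t).1.2 := by
      ext i
      rw [anchor_apply B hanch]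
      exact ((EuclideanSpace.proj (𝕜 := ℝ) i).hasFDerivAt.comp_hasDerivAt t
        hξ'.fst.fst).unique (e1 i)
    have hξy : (deriv ξ t).1.2 = (ξ t).2 := by
      ext A
      exact (hasDerivAt_pi.1 hξ'.fst.snd A).unique (e2 A)
    -- The first component must be (y, z); the equations ẋ = ρy and ẏ = z say precisely that the
    -- anchor then returns the velocity of `w`.
    let Z : TW n := (((ξ t).1.2, (ξ t).2), ((deriv ξ t).2, deriv α t))
    have hd : HasDerivAt w ((tangentW B).anchor (w t) Z) t := by
      have h1 : HasDerivAt w ((deriv ξ t).1, ((deriv ξ t).2, deriv α t)) t :=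
        hξ'.fst.prodMk (hξ'.snd.prodMk hα')
      have h2 : (deriv ξ t).1 = (B.anchor (ξ t).1.1 (ξ t).1.2, (ξ t).2) := Prod.ext hξx hξy
      rw [h2] at h1
      exact h1
    refine ⟨Z, hd, mem_velocities_of_hasDerivAt hI hw hwS ht hd, ?_⟩
    refine (defect_eq_iff B (w := w t) (hLd t ht) (hΦd t ht) (l t) Z).2
      ⟨rfl, fun A => hα2 t A, fun A => ?_, fun A => ?_⟩
    · change deriv α t (0, Pi.single A 1) = pdy (Lt t) A (ξ t) - α t (Pi.single A 1, 0)
      rw [hα1, sub_sub_cancel]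
      have h1 := hαv (0, Pi.single A 1)
      simp only [hα2] at h1
      exact h1.deriv.symm
    -- The other components hold by the choice of α and `Z`; the second-order equation is needed
    -- only here, for dp_A/dt.
    · rw [momentum_str_single B hstr hC, fderiv_anchor_single B hanch]
      have h1 := hαv (Pi.single A 1, 0)
      simp only [hα1] at h1
      have hy := (differentiableAt_of_contDiffOn hI (hPy A) ht).hasDerivAt
      have hzz := (differentiableAt_of_contDiffOn hI (hPz' A) ht).hasDerivAt
      have h2 := h1.unique (hy.sub hzz)
      change deriv α t (Pi.single A 1, 0) = -(∑ b, ∑ d, C A b d (ξ t).1.1 * (ξ t).1.2 b *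
        α t (Pi.single d 1, 0)) + ∑ i, rho A i (ξ t).1.1 * pdx (Lt t) i (ξ t)
      have h3 : 0 = deriv (deriv fun s => pdz (Lt s) A (ξ s)) t
        + ∑ b, ∑ d, C A b d (ξ t).1.1 * (ξ t).1.2 b * deriv (fun s => pdz (Lt s) d (ξ s)) t
        - deriv (fun s => pdy (Lt s) A (ξ s)) t
        - ∑ b, ∑ d, C A b d (ξ t).1.1 * (ξ t).1.2 b * pdy (Lt t) d (ξ t)
        + ∑ i, rho A i (ξ t).1.1 * pdx (Lt t) i (ξ t) := e3 A
      simp only [hα1, mul_sub, Finset.sum_sub_distrib]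
      rw [h2]
      linarith

end EulerLagrangeEquiv

/-! ### The local expression of a Lie algebroid -/

namespace LieAlgebroid

variable {m n : ℕ} {M : Type*} [TopologicalSpace M] [ChartedSpace (EuclideanSpace ℝ (Fin m)) M]
  {E : M → Type*} [TopologicalSpace (Bundle.TotalSpace (EuclideanSpace ℝ (Fin n)) E)]
  [∀ x, AddCommGroup (E x)] [∀ x, Module ℝ (E x)] [∀ x, TopologicalSpace (E x)]
  [FiberBundle (EuclideanSpace ℝ (Fin n)) E]
  [IsManifold (𝓡 m) ∞ M] [VectorBundle ℝ (EuclideanSpace ℝ (Fin n)) E]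
  (A : LieAlgebroid m n M E)
  (φ : OpenPartialHomeomorph M (EuclideanSpace ℝ (Fin m))) {e : Fin n → ∀ p, E p}
  (he : IsLocalFrameOn (𝓡 m) (EuclideanSpace ℝ (Fin n)) ∞ e φ.source)

theorem localForm_anchor_apply (x : X m) (u : Y n) : (A.localForm φ he).anchor x u =
    ∑ a, u a • ∑ i, A.rho φ e a i x • EuclideanSpace.single i (1 : ℝ) := by
  simp only [localForm, LinearMap.sum_apply, LinearMap.smulRight_apply, LinearMap.proj_apply]

theorem localForm_str_apply (x : X m) (u v : Y n) (d : Fin n) :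
    (A.localForm φ he).str x u v d =
      ∑ a, ∑ b, A.structC φ he a b d x * (u a * v b) := by
  simp only [localForm, LinearMap.sum_apply, LinearMap.smul_apply, Finset.sum_apply]
  refine Finset.sum_congr rfl fun a _ => Finset.sum_congr rfl fun b _ => ?_
  rw [Finset.sum_eq_single d]
  · simp
  · intro c _ hc
    simp [hc.symm]
  · simp

/-- Both orders of the local bracket use the same global extensions of the two frame sections, so
antisymmetry of the global bracket carries over. -/
theorem structC_antisymm (a b c : Fin n) (x : X m) :
    A.structC φ he a b c x = -A.structC φ he b a c x := by
  rw [structC, structC, ← map_neg]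
  congr 1
  rw [localBracket, A.bracket_antisymm]
  rfl

end LieAlgebroid

end SecondOrderAlgebroid

theorem mainTheorem4 {m n k : ℕ}
    {M : Type*} [TopologicalSpace M] [ChartedSpace (EuclideanSpace ℝ (Fin m)) M]
    [IsManifold (𝓡 m) ∞ M] [T2Space M]
    {E : M → Type*} [TopologicalSpace (Bundle.TotalSpace (EuclideanSpace ℝ (Fin n)) E)]
    [∀ p, AddCommGroup (E p)] [∀ p, Module ℝ (E p)] [∀ p, TopologicalSpace (E p)]
    [FiberBundle (EuclideanSpace ℝ (Fin n)) E] [VectorBundle ℝ (EuclideanSpace ℝ (Fin n)) E]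
    [ContMDiffVectorBundle ∞ (EuclideanSpace ℝ (Fin n)) E (𝓡 m)]
    -- a Lie algebroid, a chart of `M` and a frame of `E` over its domain
    (A : LieAlgebroid m n M E)
    (φ : OpenPartialHomeomorph M (EuclideanSpace ℝ (Fin m)))
    (hφ : φ ∈ IsManifold.maximalAtlas (𝓡 m) ∞ M)
    (e : Fin n → ∀ p, E p)
    (he : IsLocalFrameOn (𝓡 m) (EuclideanSpace ℝ (Fin n)) ∞ e φ.source)
    -- an open set of coordinates on `E⁽²⁾`
    (D : Set (E2 m n)) (hD : IsOpen D) (hDφ : ∀ ξ ∈ D, ξ.1.1 ∈ φ.target)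
    -- the constraint subset of `E⁽²⁾` and its constraint functions on `D`
    (𝓜 : Set (TangentBundle ((𝓡 m).prod 𝓘(ℝ, EuclideanSpace ℝ (Fin n)))
      (Bundle.TotalSpace (EuclideanSpace ℝ (Fin n)) E)))
    (h𝓜E : 𝓜 ⊆ A.admissible) (Φ : Fin k → E2 m n → ℝ)
    (hΦ : ∀ a, ContDiffOn ℝ ∞ (Φ a) D)
    (h𝓜 : ∀ ξ ∈ D, ξ ∈ A.exprSet φ he 𝓜 ↔ ∀ a, Φ a ξ = 0)
    (hrank : ∀ ξ ∈ D, (∀ a, Φ a ξ = 0) →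
      LinearIndependent ℝ (fun (a : Fin k) (b : Fin n) => pdz (Φ a) b ξ))
    -- the Lagrangian on `𝓜` and an arbitrary extension to `E⁽²⁾`
    (LM : 𝓜 → ℝ) (L : A.admissible → ℝ)
    (hext : ∀ ξ : 𝓜, L ⟨ξ, h𝓜E ξ.2⟩ = LM ξ)
    (hL : ContDiffOn ℝ ∞ (A.expr φ he L) D) :
    let B := A.localForm φ he
    let S := Wbar D (A.exprSet φ he 𝓜)
    let H := pontryagin (A.expr φ he LM)
    let ℓ := A.expr φ he L
    -- the presymplectic equation on `W̄₀` in extrinsic form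
    (∀ w ∈ S, ∀ Z : TW n, IntrinsicEq B S H w Z ↔
      defect B ℓ w Z ∈ ann B S w ∧ Z ∈ tangentSub B S w) ∧
    -- the annihilator is spanned by the differentials of the constraints
    (∀ w ∈ S, ann B S w =
      (Submodule.span ℝ (Set.range fun a => dConstraint B Φ a w) : Set (TW n →ₗ[ℝ] ℝ))) ∧
    -- the presymplectic equation with Lagrange multipliers
    (∀ w ∈ S, ∀ Z : TW n, IntrinsicEq B S H w Z ↔
      (∃ μ : Fin k → ℝ, defect B ℓ w Z = ∑ a, μ a • dConstraint B Φ a w) ∧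
        Z ∈ tangentSub B S w) ∧
    (∀ (I : Set ℝ), IsOpen I → ∀ w : ℝ → W m n, ContDiffOn ℝ ∞ w I →
      (SolvesIntrinsic B S H I w ↔
        ∃ μ : ℝ → Fin k → ℝ, ContDiffOn ℝ ∞ μ I ∧ SolvesExtrinsic B S ℓ Φ I w μ)) ∧
    -- given multipliers: the extrinsic system amounts to the second-order equations
    (∀ (I : Set ℝ), IsOpen I → ∀ ξ : ℝ → E2 m n, ContDiffOn ℝ ∞ ξ I → (∀ t ∈ I, ξ t ∈ D) →
      ∀ l : ℝ → Fin k → ℝ, ContDiffOn ℝ ∞ l I →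
        ((∃ w : ℝ → W m n, ContDiffOn ℝ ∞ w I ∧ (∀ t ∈ I, π₁ (w t) = ξ t) ∧
            SolvesExtrinsic B S ℓ Φ I w (fun t => -l t)) ↔
          IsEulerLagrange (A.rho φ e) (A.structC φ he) ℓ Φ I ξ l)) ∧
    -- the dynamics of the presymplectic system
    (∀ (I : Set ℝ), IsOpen I → ∀ ξ : ℝ → E2 m n, ContDiffOn ℝ ∞ ξ I → (∀ t ∈ I, ξ t ∈ D) →
      ((∃ w : ℝ → W m n, ContDiffOn ℝ ∞ w I ∧ (∀ t ∈ I, π₁ (w t) = ξ t) ∧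
          SolvesIntrinsic B S H I w) ↔
        ∃ l : ℝ → Fin k → ℝ, ContDiffOn ℝ ∞ l I ∧
          IsEulerLagrange (A.rho φ e) (A.structC φ he) ℓ Φ I ξ l)) := by
  intro B S H ℓ
  -- Over W̄₀ neither `expr` takes its default value 0, and there the extension restricts to `LM`.
  -- Off W̄₀ the two functions may differ.
  have hHeq : ∀ w ∈ S, H w = pontryagin ℓ w := fun w hw => by
    have hE : A.elem φ he (π₁ w) ∈ 𝓜 := hw.2
    simp only [H, ℓ, pontryagin, LieAlgebroid.expr, dif_pos hE, dif_pos (h𝓜E hE)]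
    rw [← hext]
  have hℓ : ∀ w ∈ S, DifferentiableAt ℝ ℓ (π₁ w) := fun w hw =>
    differentiableAt_of_contDiffOn hD hL hw.1
  have hann : ∀ w ∈ S, ann B S w =
      (Submodule.span ℝ (Set.range fun a => dConstraint B Φ a w) : Set (TW n →ₗ[ℝ] ℝ)) :=
    fun w hw => ann_eq_span B hD hΦ h𝓜 hrank hw
  have hEL := fun (I : Set ℝ) (hI : IsOpen I) (ξ : ℝ → E2 m n) (hξ : ContDiffOn ℝ ∞ ξ I)
      (hξD : ∀ t ∈ I, ξ t ∈ D) (l : ℝ → Fin k → ℝ) (hl : ContDiffOn ℝ ∞ l I) =>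
    exists_solvesExtrinsic_iff B hD hΦ h𝓜 (A.localForm_anchor_apply φ he)
      (A.localForm_str_apply φ he) (A.structC_antisymm φ he) hL hI hξ hξD hl
  refine ⟨fun w hw Z => intrinsicEq_iff B hHeq (hℓ w hw) Z, hann, fun w hw Z => ?_,
    fun I hI w hw => solvesIntrinsic_iff B hD hΦ h𝓜 hrank hHeq hL hI hw, hEL,
    fun I hI ξ hξ hξD => ?_⟩
  · rw [intrinsicEq_iff B hHeq (hℓ w hw) Z, hann w hw, SetLike.mem_coe,
      Submodule.mem_span_range_iff_exists_fun]
    simp only [eq_comm]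
  · constructor
    · rintro ⟨w, hw, hwξ, hs⟩
      obtain ⟨μ, hμ, hs⟩ := (solvesIntrinsic_iff B hD hΦ h𝓜 hrank hHeq hL hI hw).1 hs
      exact ⟨fun t => -μ t, hμ.neg, (hEL I hI ξ hξ hξD _ hμ.neg).1
        ⟨w, hw, hwξ, by simpa only [neg_neg] using hs⟩⟩
    · rintro ⟨l, hl, h⟩
      obtain ⟨w, hw, hwξ, hs⟩ := (hEL I hI ξ hξ hξD l hl).2 h
      exact ⟨w, hw, hwξ, (solvesIntrinsic_iff B hD hΦ h𝓜 hrank hHeq hL hI hw).2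
        ⟨fun t => -l t, hl.neg, hs⟩⟩
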